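/- Let $D$ be a diagram of an oriented tangle: finitely many crossings, each positive or negative, and finitely many boundary points, joined by oriented edges, together with finitely many circles without crossings. (Only this combinatorial data is used; planarity plays no role.) An edge is internal if it is disjoint from the boundary. A marking of $D$ is a choice of finitely many marks in the interiors of the edges and on the circles, with at least one mark on each internal edge and on each circle. Ground rings are bigraded by $\deg a=(2,0)$, $\deg x=(0,2)$ for every other variable $x$, and $\{s,t\}$ is the bidegree shift by $(s,t)$. Let $R=\mathbb Q[a,x_i]$, where $i$ runs over the boundary points of $D$, and let $w=a\sum_i\epsilon_i x_i$, where $\epsilon_i=1$ if the strand leaves $D$ at $i$ and $\epsilon_i=-1$ if it enters. Let $hmf_w$ be the category whose objects are pairs $(M,d)$ with $M=M^0\oplus M^1$ a free bigraded $R$-module, possibly of infinite rank, and $d:M^0\to M^1\to M^0$ of bidegree $(1,1)$ with $d^2=w$, and whose morphisms are the bidegree-preserving $R$-linear maps $M^0\to N^0$, $M^1\to N^1$ commuting with $d$, modulo those of the form $dh+hd$ with $h$ of parity $1$ and bidegree $(-1,-1)$. Let $K(hmf_w)$ be the category of complexes of objects of $hmf_w$, with chain maps modulo null-homotopic ones.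 Given a marking, attach a variable to every boundary point and every mark, and let $S$ be the polynomial ring over $\mathbb Q$ in $a$ and all these variables. The labelled points cut the edges and circles into arcs; an arc is a segment, oriented from a labelled point $y$ to the next labelled point $x$, between consecutive labelled points on the same edge or circle. Put $$C_c=\bigl(S\xrightarrow{a}S\{-1,1\}\xrightarrow{x-y}S\bigr)$$ for such an arc $c$. At a crossing $p$ let $x_1,x_2$ be the variables of the nearest labelled points on the left and right outgoing edges, and $x_3,x_4$ those on the right and left incoming edges. Let $$C(\Gamma^0)=\bigl(S\xrightarrow{a}S\{-1,1\}\xrightarrow{x_1-x_4}S\bigr)\otimes_S\bigl(S\xrightarrow{a}S\{-1,1\}\xrightarrow{x_2-x_3}S\bigr),$$ $$C(\Gamma^1)=\bigl(S\xrightarrow{a}S\{-1,1\}\xrightarrow{x_1+x_2-x_3-x_4}S\bigr)\otimes_S\bigl(S\xrightarrow{0}S\{-1,3\}\xrightarrow{x_1x_2-x_3x_4}S\bigr).$$ In the product bases (even part $|00\rangle,|11\rangle$, odd part $|10\rangle,|01\rangle$), let $\chi_0:C(\Gamma^0)\to C(\Gamma^1)$ be given by the matrices $\begin{pmatrix}x_4-x_2&0\\0&1\end{pmatrix}$,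 $\begin{pmatrix}x_4&-x_2\\-1&1\end{pmatrix}$, and $\chi_1:C(\Gamma^1)\to C(\Gamma^0)$ by $\begin{pmatrix}1&0\\0&x_4-x_2\end{pmatrix}$, $\begin{pmatrix}1&x_2\\1&x_4\end{pmatrix}$. Put $$C_p=\bigl(0\to C(\Gamma^0)\{0,2\}\xrightarrow{\chi_0}C(\Gamma^1)\to0\bigr)\ \text{if } p \text{ is positive},\qquad C_p=\bigl(0\to C(\Gamma^1)\{0,-2\}\xrightarrow{\chi_1}C(\Gamma^0)\{0,-2\}\to0\bigr)\ \text{if } p \text{ is negative},$$ with $C(\Gamma^1)$ in cohomological degree $0$ in both cases. Let $C(D)$ be the tensor product over $S$ of the $C_p$ over all crossings $p$ and of the $C_c$ over all arcs $c$ (each $C_c$ placed in cohomological degree $0$). Its terms, viewed over $R$, are objects of $hmf_w$, and $C(D)$ is an object of $K(hmf_w)$. **Proposition.** Up to isomorphism in $K(hmf_w)$, the complex $C(D)$ does not depend on the number and the position of the marks: for any two markings of $D$ the resulting complexes $C(D)$ are isomorphic in $K(hmf_w)$. -/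

import Mathlib

open CategoryTheory MvPolynomial

namespace KR

/-! ### Ground rings, gradings, and the categories of matrix factorizations -/

/-- Degrees: the `ℤ/2`-part records the summand `M⁰` or `M¹` of a factorization,
the `ℤ × ℤ`-part records the bidegree. -/
abbrev Deg : Type := ZMod 2 × ℤ × ℤ

/-- The degree of the differential of a factorization: it exchanges `M⁰` and `M¹`
and has bidegree `(1, 1)`. -/
def dDeg : Deg := (1, 1, 1)

/-- The polynomial ring `ℚ[a, x_i : i ∈ I]`; the variable `a` is `X none`,
the variable `x_i` is `X (some i)`. -/
abbrev Ground (I : Type) : Type := MvPolynomial (Option I) ℚ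

/-- `deg a = (2, 0)` and `deg x_i = (0, 2)`. -/
def varDeg (I : Type) : Option I → Deg
  | none => (0, 2, 0)
  | some _ => (0, 0, 2)

/-- A matrix factorization `(M, d)` with potential `w` over `R = ℚ[a, x_i : i ∈ I]`:
`M = M⁰ ⊕ M¹` is a free bigraded `R`-module (possibly of infinite rank), `d` exchanges
`M⁰` and `M¹`, has bidegree `(1, 1)`, and `d² = w`. The homogeneous elements of `Mⁱ` of
bidegree `(k, l)` are `gr (i, k, l)`. The field `free` says that `M` has a homogeneous
`R`-basis, that is, `M ≅ ⨁ R{δ i}` as graded modules. -/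
structure MF (I : Type) (w : Ground I) where
  carrier : Type
  [addCommGroup : AddCommGroup carrier]
  [module : Module (Ground I) carrier]
  gr : Deg → AddSubgroup carrier
  free : ∃ (ι : Type) (b : Module.Basis ι (Ground I) carrier) (δ : ι → Deg),
    ∀ (g : Deg) (m : carrier),
      m ∈ gr g ↔ ∀ i, IsWeightedHomogeneous (varDeg I) (b.repr m i) (g - δ i)
  d : carrier →ₗ[Ground I] carrier
  d_deg : ∀ (g : Deg) (m : carrier), m ∈ gr g → d m ∈ gr (g + dDeg)
  d_sq : ∀ m : carrier, d (d m) = w • m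

attribute [instance] MF.addCommGroup MF.module

namespace MF

variable {I : Type} {w : Ground I}

/-- Morphisms of factorizations: degree-preserving `R`-linear maps commuting with `d`. -/
noncomputable def homs (M N : MF I w) : AddSubgroup (M.carrier →ₗ[Ground I] N.carrier) where
  carrier := {f | (∀ g, ∀ m ∈ M.gr g, f m ∈ N.gr g) ∧ ∀ m, f (M.d m) = N.d (f m)}
  add_mem' := by
    rintro f f' ⟨h1, h2⟩ ⟨h1', h2'⟩
    exact ⟨fun g m hm => (N.gr g).add_mem (h1 g m hm) (h1' g m hm),
      fun m => by simp [h2, h2']⟩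
  zero_mem' := ⟨fun g m _ => (N.gr g).zero_mem, fun m => by simp⟩
  neg_mem' := by
    rintro f ⟨h1, h2⟩
    exact ⟨fun g m hm => (N.gr g).neg_mem (h1 g m hm), fun m => by simp [h2]⟩

/-- The category `mf_w`. -/
noncomputable instance : Category (MF I w) where
  Hom M N := homs M N
  id M := ⟨LinearMap.id, fun _ _ hm => hm, fun _ => rfl⟩
  comp f g := ⟨g.1.comp f.1, fun k m hm => g.2.1 k _ (f.2.1 k m hm),
    fun m => by
      change g.1 (f.1 _) = _
      rw [f.2.2, g.2.2]; rfl⟩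

noncomputable instance : Preadditive (MF I w) where
  homGroup M N := inferInstanceAs (AddCommGroup (homs M N))
  add_comp := by
    intro P Q R f f' g
    exact Subtype.ext (LinearMap.ext fun m => g.1.map_add _ _)
  comp_add := by
    intro P Q R f g g'
    exact Subtype.ext (LinearMap.ext fun m => rfl)

/-- A morphism is null-homotopic if it is `dh + hd` for an `R`-linear map `h` that exchanges
`M⁰` and `M¹` and has bidegree `(-1, -1)`. -/
def NullHomotopic {M N : MF I w} (f : M ⟶ N) : Prop :=
  ∃ h : M.carrier →ₗ[Ground I] N.carrier,
    (∀ g, ∀ m ∈ M.gr g, h m ∈ N.gr (g - dDeg)) ∧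
    ∀ m, f.1 m = N.d (h m) + h (M.d m)

variable (I w) in
/-- Chain homotopy of morphisms of factorizations. -/
def homotopic : HomRel (MF I w) := fun _ _ f g => NullHomotopic (f - g)

theorem NullHomotopic.add {M N : MF I w} {f g : M ⟶ N} (hf : NullHomotopic f)
    (hg : NullHomotopic g) : NullHomotopic (f + g) := by
  obtain ⟨h, h1, h2⟩ := hf
  obtain ⟨k, k1, k2⟩ := hg
  refine ⟨h + k, fun g m hm => (N.gr _).add_mem (h1 g m hm) (k1 g m hm), fun m => ?_⟩
  change f.1 m + g.1 m = _
  rw [h2, k2]; simp only [LinearMap.add_apply, map_add]; abel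

theorem NullHomotopic.neg {M N : MF I w} {f : M ⟶ N} (hf : NullHomotopic f) :
    NullHomotopic (-f) := by
  obtain ⟨h, h1, h2⟩ := hf
  refine ⟨-h, fun g m hm => (N.gr _).neg_mem (h1 g m hm), fun m => ?_⟩
  change -f.1 m = _
  rw [h2]; simp only [LinearMap.neg_apply, map_neg]; abel

theorem NullHomotopic.zero (M N : MF I w) : NullHomotopic (0 : M ⟶ N) :=
  ⟨0, fun _ _ _ => (N.gr _).zero_mem, fun m => by
    change (0 : N.carrier) = _
    simp⟩

instance : Congruence (homotopic I w) where
  equivalence :=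
    { refl := fun f => by
        unfold homotopic; rw [sub_self]; exact NullHomotopic.zero _ _
      symm := fun {f g} h => by
        unfold homotopic at *; rw [← neg_sub]; exact h.neg
      trans := fun {f g k} h h' => by
        unfold homotopic at *; rw [← sub_add_sub_cancel f g k]; exact h.add h' }
  comp_left := by
    intro X Y Z f g g' h
    unfold homotopic at *
    rw [← Preadditive.comp_sub]
    obtain ⟨h, h1, h2⟩ := h
    refine ⟨h.comp f.1, fun k m hm => h1 k _ (f.2.1 k m hm), fun m => ?_⟩
    change (g - g').1 (f.1 m) = _
    rw [h2, ← f.2.2]; rfl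
  comp_right := by
    intro X Y Z f f' g h
    unfold homotopic at *
    rw [← Preadditive.sub_comp]
    obtain ⟨h, h1, h2⟩ := h
    refine ⟨g.1.comp h, fun k m hm => g.2.1 _ _ (h1 k m hm), fun m => ?_⟩
    change g.1 ((f - f').1 m) = _
    rw [h2, map_add, g.2.2]; rfl

end MF

/-- The category `hmf_w` of matrix factorizations up to chain homotopy. -/
abbrev HMF (I : Type) (w : Ground I) : Type 1 := Quotient (MF.homotopic I w)

noncomputable instance (I : Type) (w : Ground I) : Preadditive (HMF I w) :=
  Quotient.preadditive _ (fun X Y f₁ f₂ g₁ g₂ h h' => by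
    unfold MF.homotopic at *
    rw [add_sub_add_comm]; exact h.add h')

/-- The category `K(hmf_w)`: complexes in `hmf_w` up to chain homotopy. -/
abbrev KHMF (I : Type) (w : Ground I) := HomotopyCategory (HMF I w) (ComplexShape.up ℤ)

/-! ### Finite rank factorizations over the ring with the internal variables -/

/-- The polynomial ring `ℚ[a, x_i, y_n : i ∈ I, n ∈ N]`, as the ring `R[y_n : n ∈ N]` over
`R = ℚ[a, x_i : i ∈ I]`; the `y_n` are the internal variables. -/
abbrev Big (I N : Type) : Type := MvPolynomial N (Ground I)

/-- The degree of a monomial in the internal variables, each of bidegree `(0, 2)`. -/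
noncomputable def monDeg {N : Type} (m : N →₀ ℕ) : Deg :=
  Finsupp.weight (fun _ : N => ((0, 0, 2) : Deg)) m

/-- Homogeneous elements of degree `g` of the ring with internal variables, where
`deg a = (2, 0)` and all other variables have bidegree `(0, 2)`. -/
def Homog {I N : Type} (s : Big I N) (g : Deg) : Prop :=
  ∀ m : N →₀ ℕ, IsWeightedHomogeneous (varDeg I) (coeff m s) (g - monDeg m)

section Homog

variable {I N : Type}

theorem Homog.zero (g : Deg) : Homog (0 : Big I N) g := fun m => by
  rw [coeff_zero]; exact isWeightedHomogeneous_zero _ _ _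

theorem Homog.add {s t : Big I N} {g : Deg} (hs : Homog s g) (ht : Homog t g) :
    Homog (s + t) g := fun m => by
  rw [coeff_add]; exact (hs m).add (ht m)

theorem Homog.neg {s : Big I N} {g : Deg} (hs : Homog s g) : Homog (-s) g := fun m => by
  rw [coeff_neg]
  exact (weightedHomogeneousSubmodule ℚ (varDeg I) _).neg_mem (hs m)

theorem Homog.sub {s t : Big I N} {g : Deg} (hs : Homog s g) (ht : Homog t g) :
    Homog (s - t) g := by
  rw [sub_eq_add_neg]; exact hs.add ht.neg

theorem Homog.neg_one_mul {s : Big I N} {g : Deg} (hs : Homog s g) : Homog (-1 * s) g := by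
  have h : -1 * s = -s := _root_.neg_one_mul s
  rw [h]; exact hs.neg

theorem Homog.sum {κ : Type} (F : Finset κ) (f : κ → Big I N) {g : Deg}
    (h : ∀ k ∈ F, Homog (f k) g) : Homog (∑ k ∈ F, f k) g := by
  classical
  induction F using Finset.induction_on with
  | empty => simpa using Homog.zero g
  | insert k F hk ih =>
    rw [Finset.sum_insert hk]
    exact (h k (Finset.mem_insert_self k F)).add
      (ih fun j hj => h j (Finset.mem_insert_of_mem hj))

theorem Homog.mul {s t : Big I N} {g g' : Deg} (hs : Homog s g) (ht : Homog t g') :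
    Homog (s * t) (g + g') := fun m => by
  classical
  rw [coeff_mul]
  refine (weightedHomogeneousSubmodule ℚ (varDeg I) _).sum_mem fun p hp => ?_
  have hp' : p.1 + p.2 = m := Finset.HasAntidiagonal.mem_antidiagonal.mp hp
  have : g + g' - monDeg m = (g - monDeg p.1) + (g' - monDeg p.2) := by
    rw [← hp']; unfold monDeg; rw [map_add]; abel
  rw [this]
  exact (hs p.1).mul (ht p.2)

theorem Homog.C {r : Ground I} {g : Deg} (hr : IsWeightedHomogeneous (varDeg I) r g) :
    Homog (MvPolynomial.C r : Big I N) g := fun m => by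
  classical
  rw [coeff_C]
  split_ifs with h
  · subst h; simpa [monDeg] using hr
  · exact isWeightedHomogeneous_zero _ _ _

theorem Homog.one : Homog (1 : Big I N) 0 :=
  Homog.C (isWeightedHomogeneous_one _ _)

theorem Homog.X (n : N) : Homog (MvPolynomial.X n : Big I N) (0, 0, 2) := fun m => by
  classical
  rw [coeff_X]
  split_ifs with h
  · subst h
    simpa [monDeg, Finsupp.weight_apply] using isWeightedHomogeneous_one ℚ (varDeg I)
  · exact isWeightedHomogeneous_zero _ _ _

theorem Homog.congr {s : Big I N} {g g' : Deg} (hs : Homog s g) (h : g = g') : Homog s g' :=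
  h ▸ hs

/-- All ring elements are even: a nonzero homogeneous element lies in parity `0`. -/
theorem Homog.parity {s : Big I N} {g : Deg} (hs : Homog s g) (h : s ≠ 0) : g.1 = 0 := by
  obtain ⟨m, hm⟩ := MvPolynomial.ne_zero_iff.mp h
  obtain ⟨e, he⟩ := MvPolynomial.ne_zero_iff.mp hm
  have h1 : (g - monDeg m).1 = 0 := by
    rw [← hs m he, Finsupp.weight_apply, Finsupp.sum, Prod.fst_sum]
    refine Finset.sum_eq_zero fun i _ => ?_
    cases i <;> simp [varDeg]
  have h2 : (monDeg m).1 = 0 := by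
    rw [monDeg, Finsupp.weight_apply, Finsupp.sum, Prod.fst_sum]
    exact Finset.sum_eq_zero fun i _ => by simp
  have h3 : (g - monDeg m).1 = g.1 - (monDeg m).1 := rfl
  rw [h3, h2, sub_zero] at h1
  exact h1

end Homog

/-- `(-1)^p` for a parity `p`. -/
def psign (A : Type) [CommRing A] (p : ZMod 2) : A := if p = 0 then 1 else -1

/-- `(-1)^n` for an integer `n`. -/
def hsign (A : Type) [CommRing A] (n : ℤ) : A := if Even n then 1 else -1

theorem psign_mul_self (A : Type) [CommRing A] (p : ZMod 2) : psign A p * psign A p = 1 := by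
  unfold psign; split_ifs <;> simp

theorem psign_add_one (A : Type) [CommRing A] (p : ZMod 2) : psign A (p + 1) = -psign A p := by
  have : p = 0 ∨ p = 1 := by revert p; decide
  rcases this with rfl | rfl
  · simp [psign]
  · have : (1 : ZMod 2) + 1 = 0 := by decide
    simp [psign, this]

theorem hsign_mul_self (A : Type) [CommRing A] (n : ℤ) : hsign A n * hsign A n = 1 := by
  unfold hsign; split_ifs <;> simp

theorem hsign_add_one (A : Type) [CommRing A] (n : ℤ) : hsign A (n + 1) = -hsign A n := by
  unfold hsign; by_cases h : Even n <;> simp [h]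

/-- A factorization of finite rank over `ℚ[a, x_i, y_n]`, given by a homogeneous basis `B` with
degrees `deg`, and the matrix of `d`: the coefficient of `b` in `d c` is `d b c`. -/
structure Fact (I N : Type) where
  B : Type
  [fintype : Fintype B]
  [decEq : DecidableEq B]
  deg : B → Deg
  d : Matrix B B (Big I N)
  pot : Big I N
  d_deg : ∀ b c, Homog (d b c) (deg c + dDeg - deg b)
  d_sq : d * d = pot • (1 : Matrix B B (Big I N))

attribute [instance] Fact.fintype Fact.decEq

section Signs

variable {I N B : Type} [Fintype B] [DecidableEq B]

open Matrix in
theorem diagonal_sign_sq (p : B → ZMod 2) :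
    diagonal (fun b => psign (Big I N) (p b)) * diagonal (fun b => psign (Big I N) (p b)) = 1 := by
  rw [diagonal_mul_diagonal, ← diagonal_one]
  congr 1; funext b; exact psign_mul_self _ _

open Matrix in
theorem odd_anticomm (deg : B → Deg) (d : Matrix B B (Big I N))
    (h : ∀ b c, Homog (d b c) (deg c + dDeg - deg b)) :
    d * diagonal (fun b => psign (Big I N) (deg b).1) =
      -(diagonal (fun b => psign (Big I N) (deg b).1) * d) := by
  ext1 b c
  rw [mul_diagonal, Matrix.neg_apply, diagonal_mul]
  by_cases h0 : d b c = 0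
  · simp [h0]
  · have h1 : (deg c).1 + 1 - (deg b).1 = 0 := (h b c).parity h0
    rw [← sub_eq_zero.mp h1, psign_add_one]; ring

open Matrix in
theorem even_comm (deg : B → Deg) (D : Matrix B B (Big I N))
    (h : ∀ b c, Homog (D b c) (deg c - deg b)) :
    D * diagonal (fun b => psign (Big I N) (deg b).1) =
      diagonal (fun b => psign (Big I N) (deg b).1) * D := by
  ext1 b c
  rw [mul_diagonal, diagonal_mul]
  by_cases h0 : D b c = 0
  · simp [h0]
  · have h1 : (deg c).1 - (deg b).1 = 0 := (h b c).parity h0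
    rw [← sub_eq_zero.mp h1]; ring

end Signs

open scoped Kronecker in
theorem neg_kron {A K L K' L' : Type} [CommRing A] (P : Matrix K L A) (Q : Matrix K' L' A) :
    (-P) ⊗ₖ Q = -(P ⊗ₖ Q) := by
  ext1 i j
  simp only [Matrix.kroneckerMap_apply, Matrix.neg_apply, neg_mul]

section TensorMatrix

open Matrix
open scoped Kronecker

variable {I N B B' : Type} [DecidableEq B] [DecidableEq B']

/-- The matrix of `d ⊗ 1 + 1 ⊗ d'` with the sign rule
`(1 ⊗ d')(b ⊗ b') = (-1)^{|b|} b ⊗ d' b'`. -/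
def tensorD {A B B' : Type} [CommRing A] [DecidableEq B] [DecidableEq B'] (deg : B → Deg)
    (d : Matrix B B A) (d' : Matrix B' B' A) : Matrix (B × B') (B × B') A :=
  d ⊗ₖ (1 : Matrix B' B' A) + diagonal (fun b => psign A (deg b).1) ⊗ₖ d'

theorem tensorD_sq [Fintype B] [Fintype B'] (deg : B → Deg) (d : Matrix B B (Big I N)) (d' : Matrix B' B' (Big I N))
    (w w' : Big I N) (h : ∀ b c, Homog (d b c) (deg c + dDeg - deg b))
    (hd : d * d = w • (1 : Matrix B B (Big I N)))
    (hd' : d' * d' = w' • (1 : Matrix B' B' (Big I N))) :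
    tensorD deg d d' * tensorD deg d d' = (w + w') • (1 : Matrix (B × B') (B × B') (Big I N)) := by
  unfold tensorD
  rw [add_mul, mul_add, mul_add, ← mul_kronecker_mul, ← mul_kronecker_mul, ← mul_kronecker_mul,
    ← mul_kronecker_mul, hd, hd', odd_anticomm deg d h, diagonal_sign_sq]
  simp only [one_mul, mul_one, smul_kronecker, kronecker_smul, one_kronecker_one, add_smul]
  rw [neg_kron]; abel

theorem tensorD_deg (deg : B → Deg) (deg' : B' → Deg) (d : Matrix B B (Big I N))
    (d' : Matrix B' B' (Big I N))
    (h : ∀ b c, Homog (d b c) (deg c + dDeg - deg b))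
    (h' : ∀ b c, Homog (d' b c) (deg' c + dDeg - deg' b)) (b c : B × B') :
    Homog (tensorD deg d d' b c) (deg c.1 + deg' c.2 + dDeg - (deg b.1 + deg' b.2)) := by
  unfold tensorD
  rw [Matrix.add_apply, kroneckerMap_apply, kroneckerMap_apply]
  refine Homog.add ?_ ?_
  · by_cases hb : b.2 = c.2
    · rw [hb, one_apply_eq, mul_one]
      exact (h b.1 c.1).congr (by abel)
    · rw [one_apply_ne hb, mul_zero]; exact Homog.zero _
  · by_cases hb : b.1 = c.1
    · rw [hb, diagonal_apply_eq]
      have h0 : Homog (d' b.2 c.2) (deg c.1 + deg' c.2 + dDeg - (deg c.1 + deg' b.2)) :=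
        (h' b.2 c.2).congr (by abel)
      unfold psign
      split_ifs
      · rwa [one_mul]
      · exact h0.neg_one_mul
    · rw [diagonal_apply_ne _ hb, zero_mul]; exact Homog.zero _

end TensorMatrix

/-- The matrix of the differential of `R --p--> R --q--> R`; `false` is the basis vector of the
left-hand (and right-hand) copy of `R`, `true` that of the middle one. -/
def koszulD {A : Type} [CommRing A] (p q : A) : Matrix Bool Bool A :=
  Matrix.of fun b c =>
    match b, c with
    | true, false => p
    | false, true => q
    | _, _ => 0

/-- The degrees of the basis of `R ⟶ R{δ} ⟶ R`. -/
def koszulDeg (δ : ℤ × ℤ) (b : Bool) : Deg := bif b then (1, δ) else 0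

namespace Fact

variable {I N : Type}

/-- The tensor product of factorizations over `ℚ[a, x_i, y_n]`. -/
noncomputable def tensor (X Y : Fact I N) : Fact I N where
  B := X.B × Y.B
  deg b := X.deg b.1 + Y.deg b.2
  d := tensorD X.deg X.d Y.d
  pot := X.pot + Y.pot
  d_deg b c := tensorD_deg X.deg Y.deg X.d Y.d X.d_deg Y.d_deg b c
  d_sq := tensorD_sq X.deg X.d Y.d _ _ X.d_deg X.d_sq Y.d_sq

/-- The shift `M{s}` of the bidegree. -/
noncomputable def shift (X : Fact I N) (s : ℤ × ℤ) : Fact I N where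
  B := X.B
  deg b := X.deg b + (0, s)
  d := X.d
  pot := X.pot
  d_deg b c := (X.d_deg b c).congr (by abel)
  d_sq := X.d_sq

/-- The factorization `R --p--> R{δ} --q--> R`. -/
noncomputable def koszul (p q : Big I N) (δ : ℤ × ℤ) (hp : Homog p (0, (1, 1) - δ))
    (hq : Homog q (0, (1, 1) + δ)) : Fact I N where
  B := Bool
  deg := koszulDeg δ
  d := koszulD p q
  pot := p * q
  d_deg b c := by
    cases b <;> cases c
    · exact Homog.zero _
    · exact hq.congr (by
        ext
        · change (0 : ZMod 2) = 1 + 1 - 0; decide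
        · change 1 + δ.1 = δ.1 + 1 - 0; ring
        · change 1 + δ.2 = δ.2 + 1 - 0; ring)
    · exact hp.congr (by
        ext
        · change (0 : ZMod 2) = 0 + 1 - 1; decide
        · change 1 - δ.1 = 0 + 1 - δ.1; ring
        · change 1 - δ.2 = 0 + 1 - δ.2; ring)
    · exact Homog.zero _
  d_sq := by
    ext1 b c
    cases b <;> cases c <;> simp [koszulD, Matrix.mul_apply, mul_comm]

end Fact

/-! ### Complexes of factorizations -/

/-- A finite complex of finite rank factorizations over `ℚ[a, x_i, y_n]`, given by a homogeneous
basis `B` of the direct sum of its terms: `hdeg b` is the cohomological degree of `b`, `d` the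
matrix of the differentials of the factorizations and `del` the matrix of the (bidegree preserving)
differential of the complex. -/
structure FactComplex (I N : Type) where
  B : Type
  [fintype : Fintype B]
  [decEq : DecidableEq B]
  hdeg : B → ℤ
  deg : B → Deg
  d : Matrix B B (Big I N)
  del : Matrix B B (Big I N)
  pot : Big I N
  d_deg : ∀ b c, Homog (d b c) (deg c + dDeg - deg b)
  d_hdeg : ∀ b c, d b c ≠ 0 → hdeg b = hdeg c
  d_sq : d * d = pot • (1 : Matrix B B (Big I N))
  del_deg : ∀ b c, Homog (del b c) (deg c - deg b)
  del_hdeg : ∀ b c, del b c ≠ 0 → hdeg b = hdeg c + 1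
  del_sq : del * del = 0
  comm : d * del = del * d

attribute [instance] FactComplex.fintype FactComplex.decEq

namespace FactComplex

variable {I N : Type}

/-- A factorization as a complex concentrated in cohomological degree `0`. -/
noncomputable def single (X : Fact I N) : FactComplex I N where
  B := X.B
  hdeg _ := 0
  deg := X.deg
  d := X.d
  del := 0
  pot := X.pot
  d_deg := X.d_deg
  d_hdeg _ _ _ := rfl
  d_sq := X.d_sq
  del_deg _ _ := Homog.zero _
  del_hdeg _ _ h := absurd rfl h
  del_sq := by simp
  comm := by simp

/-- The two-term complex `0 ⟶ X --f--> Y ⟶ 0` with `X` in cohomological degree `n` and `Y` in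
cohomological degree `n + 1`. -/
noncomputable def twoTerm (X Y : Fact I N) (n : ℤ) (f : Matrix Y.B X.B (Big I N))
    (hpot : X.pot = Y.pot) (hf : ∀ b c, Homog (f b c) (X.deg c - Y.deg b))
    (hcomm : Y.d * f = f * X.d) : FactComplex I N where
  B := X.B ⊕ Y.B
  hdeg := Sum.elim (fun _ => n) (fun _ => n + 1)
  deg := Sum.elim X.deg Y.deg
  d := Matrix.fromBlocks X.d 0 0 Y.d
  del := Matrix.fromBlocks 0 0 f 0
  pot := X.pot
  d_deg := by
    rintro (b | b) (c | c)
    · exact X.d_deg b c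
    · exact Homog.zero _
    · exact Homog.zero _
    · exact Y.d_deg b c
  d_hdeg := by
    rintro (b | b) (c | c) h
    · rfl
    · exact absurd rfl h
    · exact absurd rfl h
    · rfl
  d_sq := by
    have hY := Y.d_sq
    rw [← hpot] at hY
    rw [Matrix.fromBlocks_multiply, ← Matrix.fromBlocks_one, Matrix.fromBlocks_smul, X.d_sq, hY]
    simp
  del_deg := by
    rintro (b | b) (c | c)
    · exact Homog.zero _
    · exact Homog.zero _
    · exact hf b c
    · exact Homog.zero _
  del_hdeg := by
    rintro (b | b) (c | c) h
    · exact absurd rfl h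
    · exact absurd rfl h
    · rfl
    · exact absurd rfl h
  del_sq := by simp [Matrix.fromBlocks_multiply]
  comm := by simp [Matrix.fromBlocks_multiply, hcomm]

open Matrix in
open scoped Kronecker in
/-- The tensor product over `ℚ[a, x_i, y_n]` of complexes of factorizations. The differentials `d`
are combined with the sign `(-1)^{parity}`, the differentials `del` with the sign
`(-1)^{cohomological degree}`. -/
noncomputable def tensor (X Y : FactComplex I N) : FactComplex I N where
  B := X.B × Y.B
  hdeg b := X.hdeg b.1 + Y.hdeg b.2
  deg b := X.deg b.1 + Y.deg b.2
  d := tensorD X.deg X.d Y.d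
  del := X.del ⊗ₖ (1 : Matrix Y.B Y.B (Big I N)) +
    diagonal (fun b => hsign (Big I N) (X.hdeg b)) ⊗ₖ Y.del
  pot := X.pot + Y.pot
  d_deg b c := tensorD_deg X.deg Y.deg X.d Y.d X.d_deg Y.d_deg b c
  d_hdeg := by
    intro b c h
    by_contra hne
    apply h
    unfold tensorD
    rw [Matrix.add_apply, kroneckerMap_apply, kroneckerMap_apply]
    have h1 : X.d b.1 c.1 * (1 : Matrix Y.B Y.B (Big I N)) b.2 c.2 = 0 := by
      by_contra h1
      have h2 := X.d_hdeg b.1 c.1 (left_ne_zero_of_mul h1)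
      have h3 : b.2 = c.2 := by
        by_contra h3; exact right_ne_zero_of_mul h1 (one_apply_ne h3)
      exact hne (by rw [h2, h3])
    have h1' : diagonal (fun b => psign (Big I N) (X.deg b).1) b.1 c.1 * Y.d b.2 c.2 = 0 := by
      by_contra h1
      have h2 := Y.d_hdeg b.2 c.2 (right_ne_zero_of_mul h1)
      have h3 : b.1 = c.1 := by
        by_contra h3; exact left_ne_zero_of_mul h1 (diagonal_apply_ne _ h3)
      exact hne (by rw [h2, h3])
    rw [h1, h1', add_zero]
  d_sq := tensorD_sq X.deg X.d Y.d _ _ X.d_deg X.d_sq Y.d_sq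
  del_deg := by
    intro b c
    rw [Matrix.add_apply, kroneckerMap_apply, kroneckerMap_apply]
    refine Homog.add ?_ ?_
    · by_cases hb : b.2 = c.2
      · rw [hb, one_apply_eq, mul_one]
        exact (X.del_deg b.1 c.1).congr (by abel)
      · rw [one_apply_ne hb, mul_zero]; exact Homog.zero _
    · by_cases hb : b.1 = c.1
      · rw [hb, diagonal_apply_eq]
        have h0 : Homog (Y.del b.2 c.2)
            (X.deg c.1 + Y.deg c.2 - (X.deg c.1 + Y.deg b.2)) :=
          (Y.del_deg b.2 c.2).congr (by abel)
        unfold hsign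
        split_ifs
        · rwa [one_mul]
        · exact h0.neg_one_mul
      · rw [diagonal_apply_ne _ hb, zero_mul]; exact Homog.zero _
  del_hdeg := by
    intro b c h
    by_contra hne
    apply h
    rw [Matrix.add_apply, kroneckerMap_apply, kroneckerMap_apply]
    have h1 : X.del b.1 c.1 * (1 : Matrix Y.B Y.B (Big I N)) b.2 c.2 = 0 := by
      by_contra h1
      have h2 := X.del_hdeg b.1 c.1 (left_ne_zero_of_mul h1)
      have h3 : b.2 = c.2 := by
        by_contra h3; exact right_ne_zero_of_mul h1 (one_apply_ne h3)
      exact hne (by rw [h2, h3]; ring)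
    have h1' : diagonal (fun b => hsign (Big I N) (X.hdeg b)) b.1 c.1 * Y.del b.2 c.2 = 0 := by
      by_contra h1
      have h2 := Y.del_hdeg b.2 c.2 (right_ne_zero_of_mul h1)
      have h3 : b.1 = c.1 := by
        by_contra h3; exact left_ne_zero_of_mul h1 (diagonal_apply_ne _ h3)
      exact hne (by rw [h2, h3]; ring)
    rw [h1, h1', add_zero]
  del_sq := by
    have hσ : diagonal (fun b => hsign (Big I N) (X.hdeg b)) *
        diagonal (fun b => hsign (Big I N) (X.hdeg b)) = 1 := by
      rw [diagonal_mul_diagonal, ← diagonal_one]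
      congr 1; funext b; exact hsign_mul_self _ _
    have hanti : X.del * diagonal (fun b => hsign (Big I N) (X.hdeg b)) =
        -(diagonal (fun b => hsign (Big I N) (X.hdeg b)) * X.del) := by
      ext1 b c
      rw [mul_diagonal, Matrix.neg_apply, diagonal_mul]
      by_cases h0 : X.del b c = 0
      · simp [h0]
      · rw [X.del_hdeg b c h0, hsign_add_one]; ring
    rw [add_mul, mul_add, mul_add, ← mul_kronecker_mul, ← mul_kronecker_mul,
      ← mul_kronecker_mul, ← mul_kronecker_mul, X.del_sq, Y.del_sq, hanti]
    rw [neg_kron]; simp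
  comm := by
    have hσ : X.d * diagonal (fun b => hsign (Big I N) (X.hdeg b)) =
        diagonal (fun b => hsign (Big I N) (X.hdeg b)) * X.d := by
      ext1 b c
      rw [mul_diagonal, diagonal_mul]
      by_cases h0 : X.d b c = 0
      · simp [h0]
      · rw [X.d_hdeg b c h0]; ring
    have hc : diagonal (fun b => psign (Big I N) (X.deg b).1) *
          diagonal (fun b => hsign (Big I N) (X.hdeg b)) =
        diagonal (fun b => hsign (Big I N) (X.hdeg b)) *
          diagonal (fun b => psign (Big I N) (X.deg b).1) := by
      rw [diagonal_mul_diagonal, diagonal_mul_diagonal]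
      congr 1; funext b; ring
    unfold tensorD
    simp only [add_mul, mul_add, ← mul_kronecker_mul, X.comm, Y.comm, hσ, hc,
      ← even_comm X.deg X.del X.del_deg, one_mul, mul_one]
    abel

/-- The unit of the tensor product: the ring `ℚ[a, x_i, y_n]` in cohomological degree `0`. -/
noncomputable def unit : FactComplex I N where
  B := Unit
  hdeg _ := 0
  deg _ := 0
  d := 0
  del := 0
  pot := 0
  d_deg _ _ := Homog.zero _
  d_hdeg _ _ h := absurd rfl h
  d_sq := by simp
  del_deg _ _ := Homog.zero _
  del_hdeg _ _ h := absurd rfl h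
  del_sq := by simp
  comm := by simp

/-- The tensor product of a list of complexes of factorizations. -/
noncomputable def tensorList (l : List (FactComplex I N)) : FactComplex I N :=
  l.foldr tensor unit

theorem tensorList_pot (l : List (FactComplex I N)) :
    (tensorList l).pot = (l.map FactComplex.pot).sum := by
  induction l with
  | nil => rfl
  | cons X l ih =>
    rw [List.map_cons, List.sum_cons, ← ih]; rfl

variable (X : FactComplex I N)

/-- The basis elements in cohomological degree `j`. -/
abbrev BDeg (j : ℤ) : Type := {b : X.B // X.hdeg b = j}

/-- The linear map from the `i`-th to the `j`-th term given by a block of a matrix. -/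
noncomputable def block (A : Matrix X.B X.B (Big I N)) (i j : ℤ) :
    (X.BDeg i → Big I N) →ₗ[Big I N] (X.BDeg j → Big I N) :=
  (A.submatrix (Subtype.val : X.BDeg j → X.B) (Subtype.val : X.BDeg i → X.B)).mulVecLin

theorem block_zero (i j : ℤ) (v : X.BDeg i → Big I N) : X.block 0 i j v = 0 := by
  unfold block
  rw [Matrix.submatrix_zero, Pi.zero_apply, Pi.zero_apply, Matrix.mulVecLin_apply,
    Matrix.zero_mulVec]

theorem block_comp (A A' : Matrix X.B X.B (Big I N)) (i j k : ℤ)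
    (h : ∀ b c, A' b c ≠ 0 → X.hdeg c = i → X.hdeg b = j) (v : X.BDeg i → Big I N) :
    X.block A j k (X.block A' i j v) = X.block (A * A') i k v := by
  unfold block
  rw [Matrix.mulVecLin_apply, Matrix.mulVecLin_apply, Matrix.mulVecLin_apply,
    Matrix.mulVec_mulVec]
  congr 1
  ext1 b c
  rw [Matrix.mul_apply, Matrix.submatrix_apply, Matrix.mul_apply]
  simp only [Matrix.submatrix_apply]
  rw [← Finset.sum_filter_add_sum_filter_not Finset.univ (fun e => X.hdeg e = j),
    ← Finset.sum_subtype (Finset.univ.filter fun e => X.hdeg e = j) (p := fun e => X.hdeg e = j)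
      (by simp) (fun e => A b.1 e * A' e c.1)]
  rw [left_eq_add]
  refine Finset.sum_eq_zero fun e he => ?_
  by_cases h0 : A' e c.1 = 0
  · rw [h0, mul_zero]
  · exact absurd (h e c.1 h0 c.2) (Finset.mem_filter.mp he).2

theorem block_homog (A : Matrix X.B X.B (Big I N)) (i j : ℤ) (s : Deg)
    (h : ∀ b c, Homog (A b c) (X.deg c + s - X.deg b)) (g : Deg) (v : X.BDeg i → Big I N)
    (hv : ∀ b, Homog (v b) (g - X.deg b.1)) (b : X.BDeg j) :
    Homog (X.block A i j v b) (g + s - X.deg b.1) :=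
  Homog.sum _ _ fun c _ => ((h b.1 c.1).mul (hv c)).congr (by abel)

/-- The `j`-th term of the complex, as a factorization over `R = ℚ[a, x_i]` (a free module, in
general of infinite rank), when the potential lies in `R`. -/
noncomputable def term {w : Ground I} (hw : X.pot = C w) (j : ℤ) : MF I w where
  carrier := X.BDeg j → Big I N
  gr g :=
    { carrier := {v | ∀ b, Homog (v b) (g - X.deg b.1)}
      add_mem' := fun h h' b => (h b).add (h' b)
      zero_mem' := fun _ => Homog.zero _
      neg_mem' := fun h b => (h b).neg }
  free := by
    refine ⟨_, Pi.basis fun _ : X.BDeg j => basisMonomials N (Ground I),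
      fun p => X.deg p.1.1 + monDeg p.2, fun g v => ?_⟩
    constructor
    · rintro h ⟨b, m⟩
      rw [Pi.basis_repr]
      have := h b m
      rw [sub_sub] at this
      exact this
    · intro h b m
      have := h ⟨b, m⟩
      rw [Pi.basis_repr] at this
      rw [sub_sub]
      exact this
  d := (X.block X.d j j).restrictScalars (Ground I)
  d_deg g v hv := X.block_homog X.d j j dDeg X.d_deg g v hv
  d_sq v := by
    change X.block X.d j j (X.block X.d j j v) = _
    rw [X.block_comp _ _ _ _ _ (fun b c h hc => (X.d_hdeg b c h).trans hc), X.d_sq, hw]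
    funext b
    simp only [block, Matrix.mulVecLin_apply, Matrix.mulVec, dotProduct, Matrix.submatrix_apply,
      Matrix.smul_apply, Matrix.one_apply, Subtype.val_inj]
    simp [MvPolynomial.smul_eq_C_mul]

/-- The component of the differential of the complex from the `i`-th to the `j`-th term (zero
unless `j = i + 1`). -/
noncomputable def diff {w : Ground I} (hw : X.pot = C w) (i j : ℤ) :
    X.term hw i ⟶ X.term hw j :=
  ⟨(X.block (if i + 1 = j then X.del else 0) i j).restrictScalars (Ground I), by
    constructor
    · intro g v hv
      have := X.block_homog (if i + 1 = j then X.del else 0) i j 0 (fun b c => by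
        split_ifs
        · exact (X.del_deg b c).congr (by abel)
        · exact Homog.zero _) g v hv
      rw [add_zero] at this
      exact this
    · intro (v : X.BDeg i → Big I N)
      change X.block _ i j (X.block X.d i i v) = X.block X.d j j (X.block _ i j v)
      rw [X.block_comp _ _ _ _ _ (fun b c h hc => (X.d_hdeg b c h).trans hc)]
      by_cases hij : i + 1 = j
      · rw [if_pos hij, X.block_comp _ _ _ _ _ (fun b c h hc => by rw [X.del_hdeg b c h, hc, hij]), X.comm]
      · rw [if_neg hij, Matrix.zero_mul, X.block_zero]
        exact (map_zero (X.block X.d j j)).symm⟩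

/-- The complex over `hmf_w`. -/
noncomputable def toComplex {w : Ground I} (hw : X.pot = C w) :
    CochainComplex (HMF I w) ℤ where
  X j := (Quotient.functor (MF.homotopic I w)).obj (X.term hw j)
  d i j := (Quotient.functor (MF.homotopic I w)).map (X.diff hw i j)
  shape i j hij := by
    have : X.diff hw i j = 0 := by
      apply Subtype.ext
      apply LinearMap.ext
      intro (v : X.BDeg i → Big I N)
      have hij' : ¬ (i + 1 = j) := hij
      change X.block (if i + 1 = j then X.del else 0) i j v = 0
      rw [if_neg hij', X.block_zero]
    rw [this]; rfl
  d_comp_d' i j k hij hjk := by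
    rw [← Functor.map_comp]
    have : X.diff hw i j ≫ X.diff hw j k = 0 := by
      apply Subtype.ext
      apply LinearMap.ext
      intro (v : X.BDeg i → Big I N)
      have hij' : i + 1 = j := hij
      have hjk' : j + 1 = k := hjk
      change X.block (if j + 1 = k then X.del else 0) j k
        (X.block (if i + 1 = j then X.del else 0) i j v) = 0
      rw [if_pos hij', if_pos hjk',
        X.block_comp _ _ _ _ _ (fun b c h hc => by rw [X.del_hdeg b c h, hc, hij']), X.del_sq, X.block_zero]
    rw [this]; rfl

end FactComplex

/-! ### Tangle diagrams and markings -/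

/-- The two sides of a crossing, seen along the direction of its two strands. -/
inductive Side : Type
  | left
  | right
  deriving DecidableEq

instance : Fintype Side := ⟨{Side.left, Side.right}, fun s => by cases s <;> simp⟩

/-- The combinatorial data of a diagram of an oriented tangle: the crossings with their signs,
the boundary points `Src` (resp. `Tgt`) at which a strand enters (resp. leaves) the diagram, the
circles without crossings, and the oriented edges. An edge is identified with its initial point,
a point of `Src` or one of the two outgoing ends at a crossing; `edgeEnd` gives its final point, a
point of `Tgt` or one of the two incoming ends at a crossing. The planarity of the diagram plays no
role and is not recorded. -/
structure TangleDiagram where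
  Crossing : Type
  Src : Type
  Tgt : Type
  Circle : Type
  [fintypeCrossing : Fintype Crossing]
  [fintypeSrc : Fintype Src]
  [fintypeTgt : Fintype Tgt]
  [fintypeCircle : Fintype Circle]
  positive : Crossing → Bool
  edgeEnd : (Src ⊕ Crossing × Side) ≃ (Tgt ⊕ Crossing × Side)

attribute [instance] TangleDiagram.fintypeCrossing TangleDiagram.fintypeSrc
  TangleDiagram.fintypeTgt TangleDiagram.fintypeCircle

namespace TangleDiagram

/-- The edges of a diagram, identified with their initial points. -/
abbrev Edge (D : TangleDiagram) : Type := D.Src ⊕ D.Crossing × Side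

/-- The boundary points of a diagram. -/
abbrev Bd (D : TangleDiagram) : Type := D.Src ⊕ D.Tgt

/-- An edge is internal if it is disjoint from the boundary. -/
def IsInternal (D : TangleDiagram) (e : D.Edge) : Prop := e.isRight ∧ (D.edgeEnd e).isRight

/-- The potential `w = a ∑ ε_i x_i`, the sum over the boundary points, with `ε_i = 1` where a strand
leaves the diagram and `ε_i = -1` where it enters. -/
noncomputable def potential (D : TangleDiagram) : Ground D.Bd :=
  X none * (∑ t : D.Tgt, X (some (Sum.inr t)) - ∑ s : D.Src, X (some (Sum.inl s)))

/-- A marking: finitely many marks on each edge (parametrized by `[0, 1]`, in the direction of the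
edge, marks lying in the interior) and on each circle (parametrized by `[0, 1)`), with at least one
mark on each internal edge and on each circle. -/
structure Marking (D : TangleDiagram) where
  edgeMarks : D.Edge → Finset ℝ
  circleMarks : D.Circle → Finset ℝ
  edgeMarks_mem : ∀ e, ∀ t ∈ edgeMarks e, t ∈ Set.Ioo (0 : ℝ) 1
  circleMarks_mem : ∀ c, ∀ t ∈ circleMarks c, t ∈ Set.Ico (0 : ℝ) 1
  internal_nonempty : ∀ e, D.IsInternal e → (edgeMarks e).Nonempty
  circle_nonempty : ∀ c, (circleMarks c).Nonempty

end TangleDiagram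

section LocalPieces

variable {I N : Type}

/-- The variable `a`. -/
noncomputable def aVar : Big I N := C (X none)

/-- The variable attached to a label, which is a boundary point or a mark. -/
noncomputable def var : I ⊕ N → Big I N
  | Sum.inl i => C (X (some i))
  | Sum.inr n => X n

theorem homog_a : Homog (aVar : Big I N) (0, 2, 0) :=
  Homog.C (isWeightedHomogeneous_X ℚ (varDeg I) none)

theorem homog_var : ∀ p : I ⊕ N, Homog (var p) (0, 0, 2)
  | Sum.inl i => Homog.C (isWeightedHomogeneous_X ℚ (varDeg I) (some i))
  | Sum.inr n => Homog.X n

/-- The factorization `R --a--> R{-1,1} --(x - y)--> R` of an oriented arc from `y` to `x`. -/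
noncomputable def arc (y x : I ⊕ N) : Fact I N :=
  Fact.koszul aVar (var x - var y) (-1, 1) (homog_a.congr rfl)
    (((homog_var x).sub (homog_var y)).congr rfl)

/-- The matrix of `χ₀`; on the basis `00, 11` of the even part it is
`(x₄ - x₂, 0; 0, 1)`, on the basis `10, 01` of the odd part it is `(x₄, -x₂; -1, 1)`. -/
def chi0Matrix {A : Type} [CommRing A] (x₂ x₄ : A) : Matrix (Bool × Bool) (Bool × Bool) A :=
  Matrix.of fun b c =>
    match b, c with
    | (false, false), (false, false) => x₄ - x₂
    | (true, true), (true, true) => 1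
    | (true, false), (true, false) => x₄
    | (true, false), (false, true) => -x₂
    | (false, true), (true, false) => -1
    | (false, true), (false, true) => 1
    | _, _ => 0

/-- The matrix of `χ₁`; on the basis `00, 11` of the even part it is
`(1, 0; 0, x₄ - x₂)`, on the basis `10, 01` of the odd part it is `(1, x₂; 1, x₄)`. -/
def chi1Matrix {A : Type} [CommRing A] (x₂ x₄ : A) : Matrix (Bool × Bool) (Bool × Bool) A :=
  Matrix.of fun b c =>
    match b, c with
    | (false, false), (false, false) => 1
    | (true, true), (true, true) => x₄ - x₂
    | (true, false), (true, false) => 1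
    | (true, false), (false, true) => x₂
    | (false, true), (true, false) => 1
    | (false, true), (false, true) => x₄
    | _, _ => 0

theorem chi0Matrix_comm {A : Type} [CommRing A] (a x₁ x₂ x₃ x₄ : A) :
    tensorD (koszulDeg (-1, 1)) (koszulD a (x₁ + x₂ - x₃ - x₄)) (koszulD 0 (x₁ * x₂ - x₃ * x₄)) *
        chi0Matrix x₂ x₄ =
      chi0Matrix x₂ x₄ *
        tensorD (koszulDeg (-1, 1)) (koszulD a (x₁ - x₄)) (koszulD a (x₂ - x₃)) := by
  ext ⟨b1, b2⟩ ⟨c1, c2⟩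
  simp only [Matrix.mul_apply, Fintype.sum_prod_type, Fintype.sum_bool]
  cases b1 <;> cases b2 <;> cases c1 <;> cases c2 <;>
  simp [tensorD, koszulD, koszulDeg, chi0Matrix, psign] <;> ring

theorem chi1Matrix_comm {A : Type} [CommRing A] (a x₁ x₂ x₃ x₄ : A) :
    tensorD (koszulDeg (-1, 1)) (koszulD a (x₁ - x₄)) (koszulD a (x₂ - x₃)) * chi1Matrix x₂ x₄ =
      chi1Matrix x₂ x₄ *
        tensorD (koszulDeg (-1, 1)) (koszulD a (x₁ + x₂ - x₃ - x₄))
          (koszulD 0 (x₁ * x₂ - x₃ * x₄)) := by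
  ext ⟨b1, b2⟩ ⟨c1, c2⟩
  simp only [Matrix.mul_apply, Fintype.sum_prod_type, Fintype.sum_bool]
  cases b1 <;> cases b2 <;> cases c1 <;> cases c2 <;>
  simp [tensorD, koszulD, koszulDeg, chi1Matrix, psign] <;> ring

/-- The labels around a crossing or a wide edge: `x₁` on the left and `x₂` on the right outgoing
edge, `x₃` on the right and `x₄` on the left incoming edge. -/
structure Corners (I N : Type) where
  x₁ : I ⊕ N
  x₂ : I ⊕ N
  x₃ : I ⊕ N
  x₄ : I ⊕ N

namespace Corners

variable (q : Corners I N)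

/-- `C(Γ⁰)`: the oriented resolution, two arcs. -/
noncomputable def gamma0 : Fact I N := (arc q.x₄ q.x₁).tensor (arc q.x₃ q.x₂)

/-- `C(Γ¹)`: the wide edge, the tensor product of `R --a--> R{-1,1} --(x₁+x₂-x₃-x₄)--> R` and
`R --0--> R{-1,3} --(x₁x₂-x₃x₄)--> R`. -/
noncomputable def gamma1 : Fact I N :=
  (Fact.koszul aVar (var q.x₁ + var q.x₂ - var q.x₃ - var q.x₄) (-1, 1) (homog_a.congr rfl)
    (((((homog_var q.x₁).add (homog_var q.x₂)).sub (homog_var q.x₃)).sub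
      (homog_var q.x₄)).congr rfl)).tensor
  (Fact.koszul 0 (var q.x₁ * var q.x₂ - var q.x₃ * var q.x₄) (-1, 3) (Homog.zero _)
    ((((homog_var q.x₁).mul (homog_var q.x₂)).sub
      ((homog_var q.x₃).mul (homog_var q.x₄))).congr rfl))

/-- The matrix of `χ₀ : C(Γ⁰) ⟶ C(Γ¹)` in the product bases. -/
noncomputable def chi0 : Matrix q.gamma1.B q.gamma0.B (Big I N) :=
  chi0Matrix (var q.x₂) (var q.x₄)

/-- The matrix of `χ₁ : C(Γ¹) ⟶ C(Γ⁰)` in the product bases. -/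
noncomputable def chi1 : Matrix q.gamma0.B q.gamma1.B (Big I N) :=
  chi1Matrix (var q.x₂) (var q.x₄)

theorem gamma_pot : q.gamma0.pot = q.gamma1.pot := by
  change aVar * (var q.x₁ - var q.x₄) + aVar * (var q.x₂ - var q.x₃) =
    aVar * (var q.x₁ + var q.x₂ - var q.x₃ - var q.x₄) + 0 * _
  ring

theorem chi0_homog (b : q.gamma1.B) (c : q.gamma0.B) :
    Homog (q.chi0 b c) ((q.gamma0.shift (0, 2)).deg c - q.gamma1.deg b) := by
  have h1 : Homog (1 : Big I N) 0 := Homog.one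
  have h2 := homog_var q.x₂
  have h4 := homog_var q.x₄
  change Bool × Bool at b c
  change Homog _ (koszulDeg (-1, 1) c.1 + koszulDeg (-1, 1) c.2 + (0, (0, 2)) -
    (koszulDeg (-1, 1) b.1 + koszulDeg (-1, 3) b.2))
  rcases b with ⟨_ | _, _ | _⟩ <;> rcases c with ⟨_ | _, _ | _⟩
  all_goals first
    | exact Homog.zero _
    | exact h1.congr (by decide)
    | exact h1.neg.congr (by decide)
    | exact h4.congr (by decide)
    | exact h2.neg.congr (by decide)
    | exact (h4.sub h2).congr (by decide)

theorem chi1_homog (b : q.gamma0.B) (c : q.gamma1.B) :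
    Homog (q.chi1 b c) ((q.gamma1.shift (0, -2)).deg c - (q.gamma0.shift (0, -2)).deg b) := by
  have h1 : Homog (1 : Big I N) 0 := Homog.one
  have h2 := homog_var q.x₂
  have h4 := homog_var q.x₄
  change Bool × Bool at b c
  change Homog _ (koszulDeg (-1, 1) c.1 + koszulDeg (-1, 3) c.2 + (0, (0, -2)) -
    (koszulDeg (-1, 1) b.1 + koszulDeg (-1, 1) b.2 + (0, (0, -2))))
  rcases b with ⟨_ | _, _ | _⟩ <;> rcases c with ⟨_ | _, _ | _⟩
  all_goals first
    | exact Homog.zero _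
    | exact h1.congr (by decide)
    | exact h4.congr (by decide)
    | exact h2.congr (by decide)
    | exact (h4.sub h2).congr (by decide)

theorem chi0_comm : q.gamma1.d * q.chi0 = q.chi0 * q.gamma0.d := by
  exact chi0Matrix_comm _ _ _ _ _

theorem chi1_comm : q.gamma0.d * q.chi1 = q.chi1 * q.gamma1.d := by
  exact chi1Matrix_comm _ _ _ _ _

/-- The complex of a positive crossing: `0 ⟶ C(Γ⁰){0,2} --χ₀--> C(Γ¹) ⟶ 0` with `C(Γ¹)` in
cohomological degree `0`. -/
noncomputable def positiveComplex : FactComplex I N :=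
  FactComplex.twoTerm (q.gamma0.shift (0, 2)) q.gamma1 (-1) q.chi0 q.gamma_pot q.chi0_homog
    q.chi0_comm

/-- The complex of a negative crossing: `0 ⟶ C(Γ¹){0,-2} --χ₁--> C(Γ⁰){0,-2} ⟶ 0` with `C(Γ¹)` in
cohomological degree `0`. -/
noncomputable def negativeComplex : FactComplex I N :=
  FactComplex.twoTerm (q.gamma1.shift (0, -2)) (q.gamma0.shift (0, -2)) 0 q.chi1 q.gamma_pot.symm
    q.chi1_homog q.chi1_comm

end Corners

end LocalPieces

section Sums

variable {A L : Type} [CommRing A]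

theorem telescope_path (a : A) (f : L → A) : ∀ (l : List L) (hl : l ≠ []),
    ((l.zip l.tail).map fun c => a * (f c.2 - f c.1)).sum =
      a * (f (l.getLast hl) - f (l.head hl))
  | [_], _ => by simp
  | x :: y :: l, _ => by
    have ih := telescope_path a f (y :: l) (by simp)
    simp only [List.tail_cons, List.head_cons] at ih
    simp only [List.tail_cons, List.zip_cons_cons, List.map_cons, List.sum_cons, List.head_cons,
      ih]
    have h : (x :: y :: l).getLast (List.cons_ne_nil _ _) =
      (y :: l).getLast (List.cons_ne_nil _ _) := rfl
    rw [h]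
    ring

theorem telescope_cycle (a : A) (f : L → A) (l : List L) :
    ((l.zip (l.rotate 1)).map fun c => a * (f c.2 - f c.1)).sum = 0 := by
  have h : ∀ l l' : List L, l.length = l'.length →
      ((l.zip l').map fun c => a * (f c.2 - f c.1)).sum =
        a * ((l'.map f).sum - (l.map f).sum) := by
    intro l
    induction l with
    | nil => intro l' h; simp [List.length_eq_zero_iff.mp h.symm]
    | cons x l ih =>
      intro l' h
      cases l' with
      | nil => simp at h
      | cons y l' =>
        have := ih l' (by simpa using h)
        simp only [List.zip_cons_cons, List.map_cons, List.sum_cons, this]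
        ring
  rw [h _ _ (List.length_rotate ..).symm, ((List.rotate_perm l 1).map f).sum_eq, sub_self,
    mul_zero]

theorem sum_map_flatMap {κ : Type} (f : L → A) (g : κ → List L) (l : List κ) :
    ((l.flatMap g).map f).sum = (l.map fun k => ((g k).map f).sum).sum := by
  induction l with
  | nil => rfl
  | cons k l ih => simp [List.flatMap_cons, ih]

theorem sum_side (f : Side → A) : ∑ s, f s = f Side.left + f Side.right := by
  change ∑ s ∈ {Side.left, Side.right}, f s = _
  rw [Finset.sum_pair (by decide)]

end Sums

namespace TangleDiagram.Marking

variable {D : TangleDiagram} (m : D.Marking)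

/-- The marks. -/
abbrev Mark : Type :=
  (Σ e : D.Edge, {t : ℝ // t ∈ m.edgeMarks e}) ⊕ (Σ c : D.Circle, {t : ℝ // t ∈ m.circleMarks c})

/-- The labels: boundary points and marks. -/
abbrev Label : Type := D.Bd ⊕ m.Mark

/-- The labels on an edge, in the direction of the edge: the initial point, if it is a boundary
point, then the marks, then the final point, if it is a boundary point. -/
noncomputable def edgeLabels (e : D.Edge) : List m.Label :=
  (match e with
    | Sum.inl s => [Sum.inl (Sum.inl s)]
    | Sum.inr _ => []) ++
  ((Finset.univ : Finset {t : ℝ // t ∈ m.edgeMarks e}).sort.map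
    fun t => Sum.inr (Sum.inl ⟨e, t⟩)) ++
  (match D.edgeEnd e with
    | Sum.inl t => [Sum.inl (Sum.inr t)]
    | Sum.inr _ => [])

/-- The labels on a circle, in cyclic order. -/
noncomputable def circleLabels (c : D.Circle) : List m.Label :=
  (Finset.univ : Finset {t : ℝ // t ∈ m.circleMarks c}).sort.map
    fun t => Sum.inr (Sum.inr ⟨c, t⟩)

theorem edgeLabels_ne_nil (e : D.Edge) : m.edgeLabels e ≠ [] := by
  unfold edgeLabels
  rcases e with s | p
  · simp
  · rcases h : D.edgeEnd (Sum.inr p) with t | t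
    · simp
    · obtain ⟨x, hx⟩ := m.internal_nonempty (Sum.inr p) ⟨rfl, by rw [h]; rfl⟩
      intro h0
      simp only [List.nil_append, List.append_nil, List.map_eq_nil_iff] at h0
      have : (⟨x, hx⟩ : {t : ℝ // t ∈ m.edgeMarks (Sum.inr p)}) ∈
          (Finset.univ : Finset {t : ℝ // t ∈ m.edgeMarks (Sum.inr p)}).sort := by simp
      rw [h0] at this
      simp at this

/-- The first label on an edge. -/
noncomputable def firstLabel (e : D.Edge) : m.Label :=
  (m.edgeLabels e).head (m.edgeLabels_ne_nil e)

/-- The last label on an edge. -/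
noncomputable def lastLabel (e : D.Edge) : m.Label :=
  (m.edgeLabels e).getLast (m.edgeLabels_ne_nil e)

/-- The arcs into which the labels cut the edge, as pairs (initial label, final label). -/
noncomputable def edgeArcs (e : D.Edge) : List (m.Label × m.Label) :=
  (m.edgeLabels e).zip (m.edgeLabels e).tail

/-- The arcs into which the marks cut the circle, as pairs (initial label, final label). -/
noncomputable def circleArcs (c : D.Circle) : List (m.Label × m.Label) :=
  (m.circleLabels c).zip ((m.circleLabels c).rotate 1)

/-- All arcs of the marked diagram. -/
noncomputable def arcs : List (m.Label × m.Label) :=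
  (Finset.univ : Finset D.Edge).toList.flatMap m.edgeArcs ++
    (Finset.univ : Finset D.Circle).toList.flatMap m.circleArcs

/-- The labels next to a crossing. -/
noncomputable def corners (p : D.Crossing) : Corners D.Bd m.Mark where
  x₁ := m.firstLabel (Sum.inr (p, Side.left))
  x₂ := m.firstLabel (Sum.inr (p, Side.right))
  x₃ := m.lastLabel (D.edgeEnd.symm (Sum.inr (p, Side.right)))
  x₄ := m.lastLabel (D.edgeEnd.symm (Sum.inr (p, Side.left)))

/-- The complex `C_p` of a crossing `p`. -/
noncomputable def crossingComplex (p : D.Crossing) : FactComplex D.Bd m.Mark :=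
  bif D.positive p then (m.corners p).positiveComplex else (m.corners p).negativeComplex

/-- The tensor product of the `C_p` over all crossings `p` and of the `C_c` over all arcs `c`, over
the polynomial ring in `a` and all labels. -/
noncomputable def bigComplex : FactComplex D.Bd m.Mark :=
  FactComplex.tensorList
    ((Finset.univ : Finset D.Crossing).toList.map m.crossingComplex ++
      m.arcs.map fun c => FactComplex.single (arc c.1 c.2))

theorem firstLabel_src (s : D.Src) : m.firstLabel (Sum.inl s) = Sum.inl (Sum.inl s) := rfl

theorem lastLabel_tgt (t : D.Tgt) :
    m.lastLabel (D.edgeEnd.symm (Sum.inl t)) = Sum.inl (Sum.inr t) := by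
  unfold lastLabel
  rw [List.getLast_eq_iff_getLast?_eq_some]
  simp [edgeLabels]

theorem crossingComplex_pot (p : D.Crossing) : (m.crossingComplex p).pot =
    aVar * ((var (m.corners p).x₁ + var (m.corners p).x₂) -
      (var (m.corners p).x₃ + var (m.corners p).x₄)) := by
  have h : (m.crossingComplex p).pot = (m.corners p).gamma1.pot := by
    unfold crossingComplex
    cases D.positive p
    · rfl
    · exact (m.corners p).gamma_pot
  rw [h]
  change aVar * (_ + _ - _ - _) + 0 * _ = _
  ring

theorem bigComplex_pot : m.bigComplex.pot = C D.potential := by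
  have hE : ∀ e, ((m.edgeArcs e).map fun c =>
      (aVar : Big D.Bd m.Mark) * (var c.2 - var c.1)).sum =
      aVar * (var (m.lastLabel e) - var (m.firstLabel e)) := fun e =>
    telescope_path aVar var _ (m.edgeLabels_ne_nil e)
  have hC : ∀ e, ((m.circleArcs e).map fun c =>
      (aVar : Big D.Bd m.Mark) * (var c.2 - var c.1)).sum = 0 := fun e =>
    telescope_cycle aVar var _
  have hA : (m.arcs.map fun c => (aVar : Big D.Bd m.Mark) * (var c.2 - var c.1)).sum =
      ∑ e, aVar * (var (m.lastLabel e) - var (m.firstLabel e)) := by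
    unfold arcs
    rw [List.map_append, List.sum_append, sum_map_flatMap, sum_map_flatMap]
    simp only [hE, hC]
    rw [Finset.sum_map_toList, Finset.sum_map_toList]
    simp
  have hlast : ∑ e, (var (m.lastLabel e) : Big D.Bd m.Mark) =
      ∑ t : D.Tgt, var (Sum.inl (Sum.inr t)) +
      ∑ p : D.Crossing, (var (m.corners p).x₃ + var (m.corners p).x₄) := by
    rw [← D.edgeEnd.symm.sum_comp, Fintype.sum_sum_type, Fintype.sum_prod_type]
    simp only [lastLabel_tgt, sum_side]
    congr 1
    exact Finset.sum_congr rfl fun p _ => add_comm _ _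
  have hfirst : ∑ e, (var (m.firstLabel e) : Big D.Bd m.Mark) =
      ∑ s : D.Src, var (Sum.inl (Sum.inl s)) +
      ∑ p : D.Crossing, (var (m.corners p).x₁ + var (m.corners p).x₂) := by
    rw [Fintype.sum_sum_type, Fintype.sum_prod_type]
    simp only [firstLabel_src, sum_side]
    rfl
  have hw : (C D.potential : Big D.Bd m.Mark) =
      aVar * (∑ t : D.Tgt, var (Sum.inl (Sum.inr t)) - ∑ s : D.Src, var (Sum.inl (Sum.inl s))) := by
    unfold TangleDiagram.potential
    rw [C_mul, C_sub, map_sum, map_sum]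
    rfl
  have hX : m.bigComplex.pot = ∑ p, (m.crossingComplex p).pot +
      (m.arcs.map fun c => (aVar : Big D.Bd m.Mark) * (var c.2 - var c.1)).sum := by
    unfold bigComplex
    rw [FactComplex.tensorList_pot, List.map_append, List.sum_append, List.map_map, List.map_map,
      ← Finset.sum_map_toList]
    rfl
  rw [hX, hA, hw]
  simp only [crossingComplex_pot]
  rw [← Finset.mul_sum, ← Finset.mul_sum, Finset.sum_sub_distrib, Finset.sum_sub_distrib, hlast,
    hfirst]
  ring

/-- The complex `C(D)` of the marked diagram, as an object of `K(hmf_w)`. -/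
noncomputable def complex : KHMF D.Bd D.potential :=
  (HomotopyCategory.quotient _ _).obj (m.bigComplex.toComplex m.bigComplex_pot)

end TangleDiagram.Marking

end KR

/-!
The idea is that a mark can be removed together with one of the arcs that end at it. Let `z` be a
mark, and let `y ≠ z` be a neighbouring label on the same edge or circle. The arc between them
contributes a tensor factor `S --a--> S{-1,1} --l--> S` with `l = ± (z - y)`, and the rest of the
diagram contributes a complex `Y` over `S`. Killing the middle term and reducing modulo `l`, that is,
replacing `z` by `y`, defines a map from the tensor product to the reduction of `Y`, which is the
complex of the diagram without the mark `z`: the two arcs at `z`, or the arc and the crossing, merge.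
This map is a strict map of complexes. In each cohomological degree it is surjective, it has a
homogeneous linear section (polynomials not involving `z`), and division by `l` is a contracting
homotopy on its kernel. Such a morphism of factorizations is invertible in `hmf_w`
(`MF.isIso_map_of_contractible_ker`), because the section can be corrected to a morphism. Therefore
the two complexes are isomorphic already before passing to the homotopy category of complexes
(`FactComplex.Reduction.isoToComplex`); the homotopy inverses need not commute strictly with the
differential of the complex.

The factor of the arc may stand anywhere in the tensor product. The notion of a
`FactComplex.Reduction` describes the shape of the matrices that makes the argument work, and it is
preserved by tensoring with further factors on the left (`FactComplex.Reduction.tensor`), so factors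
never have to be permuted.

Removing marks one at a time, the complex of a marking is isomorphic to the complex of any smaller
marking (`TangleDiagram.Marking.Subset.nonempty_iso`), and two arbitrary markings are both smaller
than their union. The neighbour `y` of a removed mark `z` exists because every edge and every circle
carries a label of the smaller marking.
-/

namespace KR

/-! ### Homotopy equivalences of factorizations -/

/-- A morphism of factorizations with a homogeneous linear section `σ` and a kernel contracted by `H`
is a homotopy equivalence. The inverse is `σ - H (d σ - σ d)`, where the correction term turns `σ`
into a morphism. -/
theorem MF.isIso_map_of_contractible_ker {I : Type} {w : Ground I} {M N : MF I w} (π : M ⟶ N)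
    (σ : N.carrier →ₗ[Ground I] M.carrier) (H : M.carrier →ₗ[Ground I] M.carrier)
    (σ_deg : ∀ g, ∀ n ∈ N.gr g, σ n ∈ M.gr g)
    (H_deg : ∀ g, ∀ m ∈ M.gr g, H m ∈ M.gr (g - dDeg))
    (π_σ : ∀ n, π.1 (σ n) = n) (π_H : ∀ m, π.1 (H m) = 0)
    (hH : ∀ m, π.1 m = 0 → M.d (H m) + H (M.d m) = m) :
    IsIso ((Quotient.functor (MF.homotopic I w)).map π) := by
  -- the defect of `σ` as a chain map takes values in the kernel of `π`
  let Θ : N.carrier →ₗ[Ground I] M.carrier := M.d ∘ₗ σ - σ ∘ₗ N.d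
  have hΘ : ∀ n, Θ n = M.d (σ n) - σ (N.d n) := fun _ => rfl
  have π_Θ : ∀ n, π.1 (Θ n) = 0 := fun n => by
    rw [hΘ, map_sub, π.2.2, π_σ, π_σ, sub_self]
  have d_Θ : ∀ n, M.d (Θ n) = -Θ (N.d n) := fun n => by
    rw [hΘ, hΘ, map_sub, M.d_sq, N.d_sq, map_smul]; abel
  let ι : N ⟶ M := ⟨σ - H ∘ₗ Θ, by
    constructor
    · intro g n hn
      refine (M.gr g).sub_mem (σ_deg g n hn) ?_
      have h1 : Θ n ∈ M.gr (g + dDeg) :=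
        (M.gr _).sub_mem (M.d_deg g _ (σ_deg g n hn)) (σ_deg _ _ (N.d_deg g n hn))
      have h2 := H_deg _ _ h1
      rwa [add_sub_cancel_right] at h2
    · intro n
      have h := hH (Θ n) (π_Θ n)
      rw [d_Θ, map_neg] at h
      change σ (N.d n) - H (Θ (N.d n)) = M.d (σ n - H (Θ n))
      have h' := hΘ n
      rw [map_sub]
      linear_combination (norm := abel) h + h'⟩
  have hι : ∀ n, ι.1 n = σ n - H (Θ n) := fun _ => rfl
  have π_ι : ∀ n, π.1 (ι.1 n) = n := fun n => by rw [hι, map_sub, π_σ, π_H, sub_zero]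
  let F := Quotient.functor (MF.homotopic I w)
  refine ⟨F.map ι, ?_, ?_⟩
  · rw [← F.map_comp, ← F.map_id]
    apply CategoryTheory.Quotient.sound
    change NullHomotopic (π ≫ ι - 𝟙 M)
    rw [← neg_sub]
    refine NullHomotopic.neg ⟨H ∘ₗ (LinearMap.id - ι.1 ∘ₗ π.1), ?_, ?_⟩
    · intro g m hm
      exact H_deg g _ ((M.gr g).sub_mem hm (ι.2.1 g _ (π.2.1 g m hm)))
    · intro m
      have h := hH (m - ι.1 (π.1 m)) (by rw [map_sub, π_ι, sub_self])
      rw [map_sub M.d, ← ι.2.2, ← π.2.2] at h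
      exact h.symm
  · rw [← F.map_comp, ← F.map_id]
    congr 1
    exact Subtype.ext (LinearMap.ext π_ι)

/-! ### Substitution and elimination of variables -/

section

variable {I N N' : Type}

theorem Homog.pow {s : Big I N} {g : Deg} (hs : Homog s g) : ∀ k : ℕ, Homog (s ^ k) (k • g)
  | 0 => by simpa using Homog.one
  | k + 1 => by
    rw [pow_succ, succ_nsmul]
    exact (hs.pow k).mul hs

theorem Homog.finset_prod {κ : Type} (F : Finset κ) (f : κ → Big I N) (g : κ → Deg)
    (h : ∀ k ∈ F, Homog (f k) (g k)) : Homog (∏ k ∈ F, f k) (∑ k ∈ F, g k) := by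
  classical
  induction F using Finset.induction_on with
  | empty => simpa using Homog.one
  | insert k F hk ih =>
    rw [Finset.prod_insert hk, Finset.sum_insert hk]
    exact (h k (Finset.mem_insert_self k F)).mul
      (ih fun j hj => h j (Finset.mem_insert_of_mem hj))

/-- It suffices to check on monomials in the internal variables that a linear map over the ground
ring is homogeneous. -/
theorem Homog.map_of_monomial (f : Big I N →ₗ[Ground I] Big I N') (δ : Deg)
    (hf : ∀ m, Homog (f (monomial m 1)) (monDeg m + δ)) {s : Big I N} {g : Deg} (hs : Homog s g) :
    Homog (f s) (g + δ) := by
  rw [s.as_sum, map_sum]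
  refine Homog.sum _ _ fun m _ => ?_
  have h : monomial m (coeff m s) = coeff m s • (monomial m 1 : Big I N) := by
    rw [smul_monomial, smul_eq_mul, mul_one]
  rw [h, map_smul, smul_eq_C_mul]
  exact ((Homog.C (hs m)).mul (hf m)).congr (by abel)

/-- The substitution of variables given by a map of labels that fixes the boundary points. -/
noncomputable def subst (f : N → I ⊕ N') : Big I N →ₐ[Ground I] Big I N' :=
  aeval fun n => var (f n)

theorem subst_var (f : N → I ⊕ N') (x : I ⊕ N) :
    subst f (var x) = var (Sum.elim Sum.inl f x) := by
  rcases x with i | n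
  · exact aeval_C _ _
  · exact aeval_X _ _

theorem subst_aVar (f : N → I ⊕ N') : subst f aVar = aVar := aeval_C _ _

theorem monDeg_eq_sum (m : N →₀ ℕ) : monDeg m = ∑ n ∈ m.support, m n • ((0, 0, 2) : Deg) := by
  rw [monDeg, Finsupp.weight_apply, Finsupp.sum]

theorem Homog.monomial (m : N →₀ ℕ) : Homog (monomial m 1 : Big I N) (monDeg m) := by
  rw [monomial_eq, C_1, one_mul, monDeg_eq_sum]
  exact Homog.finset_prod _ _ _ fun n _ => (Homog.X n).pow _

theorem Homog.subst (f : N → I ⊕ N') {s : Big I N} {g : Deg} (hs : Homog s g) :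
    Homog (subst f s) g := by
  have h := Homog.map_of_monomial (KR.subst f).toLinearMap 0 (fun m => ?_) hs
  · rwa [add_zero] at h
  · rw [AlgHom.toLinearMap_apply, KR.subst, aeval_monomial, map_one, one_mul, add_zero,
      monDeg_eq_sum]
    exact Homog.finset_prod _ _ _ fun n _ => (homog_var _).pow _

theorem var_injective : Function.Injective (var : I ⊕ N → Big I N) := by
  rintro (i | n) (j | k) h
  · have h' : (X (some i) : Ground I) = X (some j) := C_injective _ _ h
    rw [Option.some.inj (X_injective h')]
  · have h' := congrArg constantCoeff (show C (X (some i)) = (X k : Big I N) from h)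
    rw [constantCoeff_C, constantCoeff_X] at h'
    exact absurd h' (X_ne_zero _)
  · have h' := congrArg constantCoeff (show (X n : Big I N) = C (X (some j)) from h)
    rw [constantCoeff_C, constantCoeff_X] at h'
    exact absurd h'.symm (X_ne_zero _)
  · rw [X_injective (show (X n : Big I N) = X k from h)]

/-- Division by `z - y` with remainder: the quotient is a `ℚ[a, x_i]`-linear map lowering the
bidegree by `(0, 2)`, and the remainder is obtained by replacing `z` by `y`. -/
theorem exists_quotient [DecidableEq N] (z : N) (y : I ⊕ N) :
    ∃ q : Big I N →ₗ[Ground I] Big I N,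
      (∀ s, (X z - var y) * q s =
        s - subst (fun n => if n = z then y else Sum.inr n) s) ∧
      ∀ s g, Homog s g → Homog (q s) (g - (0, 0, 2)) := by
  -- on a monomial `m z^k` with `m` prime to `z`, the quotient is `m ∑ z^i y^(k-1-i)`
  let q : Big I N →ₗ[Ground I] Big I N := (basisMonomials N (Ground I)).constr (Ground I)
    fun m => monomial (m.erase z) 1 * ∑ i ∈ Finset.range (m z), X z ^ i * var y ^ (m z - 1 - i)
  have hq : ∀ m, q (monomial m 1) =
      monomial (m.erase z) 1 * ∑ i ∈ Finset.range (m z), X z ^ i * var y ^ (m z - 1 - i) :=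
    fun m => by
      have h := (basisMonomials N (Ground I)).constr_basis (Ground I) (fun m =>
        monomial (m.erase z) (1 : Ground I) *
          ∑ i ∈ Finset.range (m z), X z ^ i * var y ^ (m z - 1 - i)) m
      rwa [coe_basisMonomials] at h
  refine ⟨q, fun s => ?_, fun s g hs => ?_⟩
  · have h : (LinearMap.mulLeft (Ground I) (X z - var y : Big I N)) ∘ₗ q =
        LinearMap.id - (subst fun n => if n = z then y else Sum.inr n).toLinearMap := by
      refine (basisMonomials N (Ground I)).ext fun m => ?_
      have hm : (monomial m 1 : Big I N) = monomial (m.erase z) 1 * X z ^ m z := by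
        rw [X_pow_eq_monomial, monomial_mul, one_mul, Finsupp.erase_add_single]
      have hs : subst (fun n => if n = z then y else Sum.inr n)
          (monomial (m.erase z) 1 : Big I N) = monomial (m.erase z) 1 := by
        rw [subst, aeval_monomial, map_one, one_mul, monomial_eq, C_1, one_mul]
        refine Finsupp.prod_congr fun n hn => ?_
        rw [if_neg (by rintro rfl; simp at hn)]
        rfl
      have hz : subst (fun n => if n = z then y else Sum.inr n) (X z : Big I N) = var y := by
        rw [subst, aeval_X, if_pos rfl]
      rw [coe_basisMonomials]
      simp only [LinearMap.comp_apply, LinearMap.mulLeft_apply, LinearMap.sub_apply,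
        LinearMap.id_apply, AlgHom.toLinearMap_apply]
      rw [hq, hm, map_mul, map_pow, hs, hz, mul_left_comm, mul_comm (X z - var y),
        geom_sum₂_mul, mul_sub]
    exact LinearMap.congr_fun h s
  · rw [sub_eq_add_neg]
    refine Homog.map_of_monomial q _ (fun m => ?_) hs
    rw [hq, Finset.mul_sum]
    refine Homog.sum _ _ fun i hi => ?_
    have hi' : i < m z := Finset.mem_range.mp hi
    refine ((Homog.monomial _).mul
      (((Homog.X z).pow i).mul ((homog_var y).pow (m z - 1 - i)))).congr ?_
    have hd : monDeg m = monDeg (m.erase z) + m z • ((0, 0, 2) : Deg) := by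
      conv_lhs => rw [← Finsupp.erase_add_single z m]
      unfold monDeg
      rw [map_add, Finsupp.weight_single]
    rw [hd, add_assoc, ← add_nsmul]
    obtain ⟨k, hk⟩ : ∃ k, m z = k + 1 := ⟨m z - 1, by omega⟩
    rw [hk, succ_nsmul, add_neg_cancel_right]
    congr 2
    omega

end

/-- The elimination of an internal variable by means of a linear form `l`: the reduction modulo
`l`, a homogeneous section `incl` of it, and a homogeneous left inverse `quot` of the
multiplication by `l`. -/
structure Elimination (I N N' : Type) where
  ρ : Big I N →ₐ[Ground I] Big I N'
  incl : Big I N' →ₐ[Ground I] Big I N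
  l : Big I N
  quot : Big I N →ₗ[Ground I] Big I N
  ρ_incl : ∀ s, ρ (incl s) = s
  ρ_l : ρ l = 0
  ρ_homog : ∀ s g, Homog s g → Homog (ρ s) g
  incl_homog : ∀ s g, Homog s g → Homog (incl s) g
  quot_homog : ∀ s g, Homog s g → Homog (quot s) (g - (0, 0, 2))
  l_mul_quot : ∀ s, ρ s = 0 → l * quot s = s
  quot_l_mul : ∀ s, quot (l * s) = s

namespace Elimination

variable {I N N' : Type}

/-- A label `z` can be eliminated by identifying it with any other label `y`. -/
theorem exists_of_ne (f : N → I ⊕ N') (j : N' → N) (hf : ∀ n, f (j n) = Sum.inr n) (z : N)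
    (hz : ∀ n, n ≠ z → ∃ n', j n' = n) (y : I ⊕ N) (hy : y ≠ Sum.inr z)
    (hzy : f z = Sum.elim Sum.inl f y) :
    ∃ E : Elimination I N N', E.ρ = subst f ∧ E.l = X z - var y := by
  classical
  obtain ⟨q, hq, hdeg⟩ := exists_quotient z y
  let incl : Big I N' →ₐ[Ground I] Big I N := subst fun n => Sum.inr (j n)
  have h1 : ∀ s, subst f (incl s) = s := by
    have h : (subst f).comp incl = AlgHom.id _ _ := by
      refine algHom_ext fun n => ?_
      change subst f (subst _ (var (Sum.inr n))) = var (Sum.inr n)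
      rw [subst_var, subst_var]
      exact congrArg var (hf n)
    exact fun s => AlgHom.congr_fun h s
  -- `incl ∘ subst f` is the substitution of `y` for `z`, the remainder of the division by `z - y`
  have hy' : Sum.map id j (Sum.elim Sum.inl f y) = y := by
    rcases y with i | n
    · rfl
    · obtain ⟨n', rfl⟩ := hz n (fun h => hy (congrArg Sum.inr h))
      simp [hf]
  have h2 : incl.comp (subst f) = subst (fun n => if n = z then y else Sum.inr n) := by
    refine algHom_ext fun n => ?_
    change subst _ (subst f (var (Sum.inr n))) = subst _ (var (Sum.inr n))
    rw [subst_var, subst_var, subst_var]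
    change var (Sum.elim Sum.inl (fun n => Sum.inr (j n)) (f n)) =
      var (if n = z then y else Sum.inr n)
    congr 1
    split_ifs with h
    · rw [h, hzy]
      exact (by cases h : Sum.elim Sum.inl f y <;> rfl :
        Sum.elim Sum.inl (fun n => Sum.inr (j n)) (Sum.elim Sum.inl f y) =
        Sum.map id j (Sum.elim Sum.inl f y)).trans hy'
    · obtain ⟨n', rfl⟩ := hz n h
      rw [hf]; rfl
  have hl : (X z - var y : Big I N) ≠ 0 := sub_ne_zero.mpr fun h =>
    hy (var_injective (show var (Sum.inr z) = var y from h)).symm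
  have hρ : subst f (X z - var y : Big I N) = 0 := by
    rw [map_sub, subst_var, show (X z : Big I N) = var (Sum.inr z) from rfl, subst_var]
    exact sub_eq_zero.mpr (congrArg var hzy)
  have hq' : ∀ s, (X z - var y) * q s = s - incl (subst f s) := fun s => by
    rw [hq, ← h2]; rfl
  exact ⟨⟨subst f, incl, X z - var y, q, h1, hρ, fun _ _ h => h.subst f, fun _ _ h => h.subst _,
    hdeg, fun s hs => by rw [hq', hs, map_zero, sub_zero],
    fun s => mul_left_cancel₀ hl (by rw [hq', map_mul, hρ, zero_mul, map_zero, sub_zero])⟩, rfl,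
    rfl⟩

end Elimination

/-! ### Base change and reduction of complexes over the ring with internal variables -/

namespace FactComplex

variable {I N N' : Type}

/-- `X'` is obtained from `X` by applying `ρ` to all matrix entries, up to a relabelling of the
basis. -/
structure BaseChange (ρ : Big I N →ₐ[Ground I] Big I N') (X : FactComplex I N)
    (X' : FactComplex I N') where
  e : X.B ≃ X'.B
  hdeg_eq : ∀ b, X'.hdeg (e b) = X.hdeg b
  deg_eq : ∀ b, X'.deg (e b) = X.deg b
  d_eq : ∀ b c, X'.d (e b) (e c) = ρ (X.d b c)
  del_eq : ∀ b c, X'.del (e b) (e c) = ρ (X.del b c)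

/-- A reduction of `X` to `X'` along the elimination `E`: the basis of `X` consists of two copies
`lo b` and `hi b` of each basis element `b` of `X'`, the block `lo → lo` of `X` becomes `X'` modulo
`l`, the block `hi → lo` of `d` is diagonal with entries `± l`, and the block `hi → hi` of `d`
is what `d² = w` forces it to be. The block `lo → hi` is arbitrary. The signs are recorded by `sign`,
as elements `1` or `-1` of the ring. -/
structure Reduction (E : Elimination I N N') (X : FactComplex I N) (X' : FactComplex I N') where
  e : X'.B ⊕ X'.B ≃ X.B
  sign : X'.B → Big I N
  sign_eq : ∀ b, sign b = 1 ∨ sign b = -1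
  hdeg_lo : ∀ b, X.hdeg (e (Sum.inl b)) = X'.hdeg b
  hdeg_hi : ∀ b, X.hdeg (e (Sum.inr b)) = X'.hdeg b
  deg_lo : ∀ b, X.deg (e (Sum.inl b)) = X'.deg b
  deg_hi : ∀ b, X.deg (e (Sum.inr b)) = X'.deg b + (1, -1, 1)
  d_lo_lo : ∀ b c, X'.d b c = E.ρ (X.d (e (Sum.inl b)) (e (Sum.inl c)))
  d_lo_hi : ∀ b c, X.d (e (Sum.inl b)) (e (Sum.inr c)) =
    (1 : Matrix X'.B X'.B (Big I N)) b c * (sign c * E.l)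
  d_hi_hi : ∀ b c, X.d (e (Sum.inr b)) (e (Sum.inr c)) * sign c =
    -(sign b * X.d (e (Sum.inl b)) (e (Sum.inl c)))
  del_lo_lo : ∀ b c, X'.del b c = E.ρ (X.del (e (Sum.inl b)) (e (Sum.inl c)))
  del_lo_hi : ∀ b c, X.del (e (Sum.inl b)) (e (Sum.inr c)) = 0

theorem map_psign (ρ : Big I N →ₐ[Ground I] Big I N') (p : ZMod 2) :
    ρ (psign _ p) = psign _ p := by
  unfold psign; split_ifs <;> simp

theorem map_hsign (ρ : Big I N →ₐ[Ground I] Big I N') (p : ℤ) :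
    ρ (hsign _ p) = hsign _ p := by
  unfold hsign; split_ifs <;> simp

theorem one_apply_of_injective {A B B' : Type} [CommRing A] [DecidableEq B] [DecidableEq B']
    {f : B → B'} (hf : Function.Injective f) (b c : B) :
    (1 : Matrix B' B' A) (f b) (f c) = (1 : Matrix B B A) b c := by
  simp only [Matrix.one_apply, hf.eq_iff]

theorem one_apply_prod {A B B' : Type} [CommRing A] [DecidableEq B] [DecidableEq B']
    (b c : B) (b' c' : B') : (1 : Matrix (B × B') (B × B') A) (b, b') (c, c') =
      (1 : Matrix B B A) b c * (1 : Matrix B' B' A) b' c' := by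
  rw [← Matrix.one_kronecker_one, Matrix.kroneckerMap_apply]

theorem map_one_apply {A A' B : Type} [CommRing A] [CommRing A'] [DecidableEq B] (ρ : A →+* A')
    (b c : B) : ρ ((1 : Matrix B B A) b c) = (1 : Matrix B B A') b c := by
  simp only [Matrix.one_apply]; split_ifs <;> simp

theorem tensor_d_apply (X Y : FactComplex I N) (b c : X.B) (b' c' : Y.B) :
    (X.tensor Y).d (b, b') (c, c') = X.d b c * (1 : Matrix Y.B Y.B (Big I N)) b' c' +
      (1 : Matrix X.B X.B (Big I N)) b c * psign _ (X.deg c).1 * Y.d b' c' := by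
  change X.d b c * (1 : Matrix Y.B Y.B (Big I N)) b' c' +
    Matrix.diagonal (fun b => psign (Big I N) (X.deg b).1) b c * Y.d b' c' = _
  congr 2
  by_cases h : b = c
  · subst h; simp
  · simp [h]

theorem tensor_del_apply (X Y : FactComplex I N) (b c : X.B) (b' c' : Y.B) :
    (X.tensor Y).del (b, b') (c, c') = X.del b c * (1 : Matrix Y.B Y.B (Big I N)) b' c' +
      (1 : Matrix X.B X.B (Big I N)) b c * hsign _ (X.hdeg c) * Y.del b' c' := by
  change X.del b c * (1 : Matrix Y.B Y.B (Big I N)) b' c' +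
    Matrix.diagonal (fun b => hsign (Big I N) (X.hdeg b)) b c * Y.del b' c' = _
  congr 2
  by_cases h : b = c
  · subst h; simp
  · simp [h]

/-- Base change is compatible with tensor products. -/
def BaseChange.tensor {ρ : Big I N →ₐ[Ground I] Big I N'} {X Y : FactComplex I N}
    {X' Y' : FactComplex I N'} (r : BaseChange ρ X X') (s : BaseChange ρ Y Y') :
    BaseChange ρ (X.tensor Y) (X'.tensor Y') where
  e := r.e.prodCongr s.e
  hdeg_eq b := congrArg₂ (· + ·) (r.hdeg_eq b.1) (s.hdeg_eq b.2)
  deg_eq b := congrArg₂ (· + ·) (r.deg_eq b.1) (s.deg_eq b.2)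
  d_eq b c := by
    refine (tensor_d_apply _ _ _ _ _ _).trans (Eq.trans ?_ (congrArg ρ
      (tensor_d_apply _ _ _ _ _ _).symm))
    simp only [map_add, map_mul, map_psign, ← RingHom.coe_coe ρ, map_one_apply]
    rw [r.d_eq, s.d_eq, one_apply_of_injective r.e.injective, one_apply_of_injective s.e.injective, r.deg_eq]
    simp only [RingHom.coe_coe]
  del_eq b c := by
    refine (tensor_del_apply _ _ _ _ _ _).trans (Eq.trans ?_ (congrArg ρ
      (tensor_del_apply _ _ _ _ _ _).symm))
    simp only [map_add, map_mul, ← RingHom.coe_coe ρ, map_one_apply]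
    rw [r.del_eq, s.del_eq, one_apply_of_injective r.e.injective, one_apply_of_injective s.e.injective, r.hdeg_eq]
    simp only [RingHom.coe_coe, map_hsign]

section arc

variable (p r : I ⊕ N) (Y : FactComplex I N) (b c : Y.B)

theorem arc_tensor_d_false_false :
    ((single (arc p r)).tensor Y).d (false, b) (false, c) = Y.d b c := by
  refine (tensor_d_apply (single (arc p r)) Y false false b c).trans ?_
  have h : (1 : Matrix (single (arc p r)).B (single (arc p r)).B (Big I N)) false false = 1 := rfl
  rw [h]
  change 0 * _ + 1 * 1 * _ = _
  ring

theorem arc_tensor_d_true_true :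
    ((single (arc p r)).tensor Y).d (true, b) (true, c) = -Y.d b c := by
  refine (tensor_d_apply (single (arc p r)) Y true true b c).trans ?_
  have h : (1 : Matrix (single (arc p r)).B (single (arc p r)).B (Big I N)) true true = 1 := rfl
  rw [h]
  change 0 * _ + 1 * -1 * _ = _
  ring

theorem arc_tensor_d_false_true : ((single (arc p r)).tensor Y).d (false, b) (true, c) =
    (var r - var p) * (1 : Matrix Y.B Y.B (Big I N)) b c := by
  refine (tensor_d_apply (single (arc p r)) Y false true b c).trans ?_
  have h : (1 : Matrix (single (arc p r)).B (single (arc p r)).B (Big I N)) false true = 0 := rfl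
  rw [h]
  change (var r - var p) * _ + 0 * _ * _ = _
  ring

theorem arc_tensor_del_false_false :
    ((single (arc p r)).tensor Y).del (false, b) (false, c) = Y.del b c := by
  refine (tensor_del_apply (single (arc p r)) Y false false b c).trans ?_
  have h : (1 : Matrix (single (arc p r)).B (single (arc p r)).B (Big I N)) false false = 1 := rfl
  have h' : hsign (Big I N) 0 = 1 := if_pos Even.zero
  rw [h]
  change 0 * _ + 1 * hsign _ 0 * _ = _
  rw [h']
  ring

theorem arc_tensor_del_false_true :
    ((single (arc p r)).tensor Y).del (false, b) (true, c) = 0 := by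
  refine (tensor_del_apply (single (arc p r)) Y false true b c).trans ?_
  have h : (1 : Matrix (single (arc p r)).B (single (arc p r)).B (Big I N)) false true = 0 := rfl
  rw [h]
  change 0 * _ + 0 * _ * _ = _
  ring

end arc

/-- Tensoring with the factorization of an arc with linear form `± l` is undone by the elimination
of a variable by means of `l`. -/
noncomputable def Reduction.arc (E : Elimination I N N') (p r : I ⊕ N)
    (ε : Big I N) (hε : ε = 1 ∨ ε = -1) (h : var r - var p = ε * E.l) {Y : FactComplex I N}
    {Y' : FactComplex I N'} (s : BaseChange E.ρ Y Y') :
    Reduction E ((single (KR.arc p r)).tensor Y) Y' where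
  e := (Equiv.boolProdEquivSum _).symm.trans (Equiv.prodCongr (Equiv.refl Bool) s.e.symm)
  sign _ := ε
  sign_eq _ := hε
  hdeg_lo b := by
    change 0 + Y.hdeg (s.e.symm b) = _
    rw [zero_add, ← s.hdeg_eq, s.e.apply_symm_apply]
  hdeg_hi b := by
    change 0 + Y.hdeg (s.e.symm b) = _
    rw [zero_add, ← s.hdeg_eq, s.e.apply_symm_apply]
  deg_lo b := by
    change 0 + Y.deg (s.e.symm b) = _
    rw [zero_add, ← s.deg_eq, s.e.apply_symm_apply]
  deg_hi b := by
    change (1, -1, 1) + Y.deg (s.e.symm b) = _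
    rw [add_comm, ← s.deg_eq, s.e.apply_symm_apply]
  d_lo_lo b c := by
    have hb := s.d_eq (s.e.symm b) (s.e.symm c)
    rw [s.e.apply_symm_apply, s.e.apply_symm_apply] at hb
    exact hb.trans (congrArg E.ρ (arc_tensor_d_false_false p r Y _ _).symm)
  d_lo_hi b c := by
    refine (arc_tensor_d_false_true p r Y _ _).trans ?_
    rw [h, mul_comm]
    exact congrArg (· * _) (one_apply_of_injective s.e.symm.injective b c)
  d_hi_hi b c := by
    refine (congrArg (· * ε) (arc_tensor_d_true_true p r Y _ _)).trans ?_
    refine Eq.trans ?_ (congrArg (fun t => -(ε * t)) (arc_tensor_d_false_false p r Y _ _).symm)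
    change -Y.d (s.e.symm b) (s.e.symm c) * ε = -(ε * Y.d (s.e.symm b) (s.e.symm c))
    ring
  del_lo_lo b c := by
    have hb := s.del_eq (s.e.symm b) (s.e.symm c)
    rw [s.e.apply_symm_apply, s.e.apply_symm_apply] at hb
    exact hb.trans (congrArg E.ρ (arc_tensor_del_false_false p r Y _ _).symm)
  del_lo_hi b c := arc_tensor_del_false_true p r Y _ _

theorem Reduction.one_apply_lo {A : Type} [CommRing A] {E : Elimination I N N'}
    {X : FactComplex I N} {X' : FactComplex I N'} (s : Reduction E X X') (b c : X'.B) :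
    (1 : Matrix X.B X.B A) (s.e (Sum.inl b)) (s.e (Sum.inl c)) =
      (1 : Matrix X'.B X'.B A) b c :=
  one_apply_of_injective (s.e.injective.comp Sum.inl_injective) b c

theorem Reduction.one_apply_hi {A : Type} [CommRing A] {E : Elimination I N N'}
    {X : FactComplex I N} {X' : FactComplex I N'} (s : Reduction E X X') (b c : X'.B) :
    (1 : Matrix X.B X.B A) (s.e (Sum.inr b)) (s.e (Sum.inr c)) =
      (1 : Matrix X'.B X'.B A) b c :=
  one_apply_of_injective (s.e.injective.comp Sum.inr_injective) b c

theorem sign_rule_lo_hi {A : Type} [CommRing A] (x o o' q t l : A) :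
    x * 0 + o * q * (o' * (t * l)) = o * o' * (q * t * l) := by ring

theorem sign_rule_hi_hi {A : Type} [CommRing A] {x y z o o' p q s t : A} (h1 : x * q = -(p * x))
    (h2 : o' * t = o' * s) (h3 : y * t = -(s * z)) (h4 : o * p = o * q) :
    (x * o' + o * q * y) * (q * t) = -(p * s * (x * o' + o * q * z)) := by
  linear_combination o' * t * h1 - p * x * h2 + o * q * q * h3 + s * q * z * h4

/-- A reduction of one factor reduces a tensor product. -/
noncomputable def Reduction.tensor {E : Elimination I N N'} {A X : FactComplex I N}
    {A' X' : FactComplex I N'} (r : BaseChange E.ρ A A') (s : Reduction E X X') :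
    Reduction E (A.tensor X) (A'.tensor X') where
  e := (Equiv.prodSumDistrib _ _ _).symm.trans (r.e.symm.prodCongr s.e)
  sign b := psign _ (A'.deg b.1).1 * s.sign b.2
  sign_eq b := by
    have h : psign (Big I N) (A'.deg b.1).1 = 1 ∨ psign (Big I N) (A'.deg b.1).1 = -1 := by
      unfold psign; split_ifs <;> simp
    rcases s.sign_eq b.2 with h1 | h1 <;> rcases h with h | h <;> rw [h1, h]
    · exact Or.inl (by ring)
    · exact Or.inr (by ring)
    · exact Or.inr (by ring)
    · exact Or.inl (by ring)
  hdeg_lo b := by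
    change A.hdeg (r.e.symm b.1) + X.hdeg (s.e (Sum.inl b.2)) = _
    rw [s.hdeg_lo, ← r.hdeg_eq, r.e.apply_symm_apply]; rfl
  hdeg_hi b := by
    change A.hdeg (r.e.symm b.1) + X.hdeg (s.e (Sum.inr b.2)) = _
    rw [s.hdeg_hi, ← r.hdeg_eq, r.e.apply_symm_apply]; rfl
  deg_lo b := by
    change A.deg (r.e.symm b.1) + X.deg (s.e (Sum.inl b.2)) = _
    rw [s.deg_lo, ← r.deg_eq, r.e.apply_symm_apply]; rfl
  deg_hi b := by
    change A.deg (r.e.symm b.1) + X.deg (s.e (Sum.inr b.2)) = _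
    rw [s.deg_hi, ← r.deg_eq, r.e.apply_symm_apply, ← add_assoc]; rfl
  d_lo_lo := by
    rintro ⟨b, b'⟩ ⟨c, c'⟩
    obtain ⟨b, rfl⟩ := r.e.surjective b
    obtain ⟨c, rfl⟩ := r.e.surjective c
    change _ = E.ρ ((A.tensor X).d (r.e.symm (r.e b), s.e (Sum.inl b'))
      (r.e.symm (r.e c), s.e (Sum.inl c')))
    rw [r.e.symm_apply_apply, r.e.symm_apply_apply]
    refine (tensor_d_apply _ _ _ _ _ _).trans (Eq.trans ?_ (congrArg E.ρ
      (tensor_d_apply _ _ _ _ _ _).symm))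
    simp only [map_add, map_mul, map_psign, ← RingHom.coe_coe E.ρ, map_one_apply]
    rw [one_apply_of_injective r.e.injective,
      s.one_apply_lo, r.d_eq, s.d_lo_lo, r.deg_eq]
    simp only [RingHom.coe_coe]
  d_lo_hi := by
    rintro ⟨b, b'⟩ ⟨c, c'⟩
    obtain ⟨b, rfl⟩ := r.e.surjective b
    obtain ⟨c, rfl⟩ := r.e.surjective c
    change (A.tensor X).d (r.e.symm (r.e b), s.e (Sum.inl b'))
      (r.e.symm (r.e c), s.e (Sum.inr c')) = (1 : Matrix (A'.B × X'.B) (A'.B × X'.B) (Big I N))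
        (r.e b, b') (r.e c, c') * (psign _ (A'.deg (r.e c)).1 * s.sign c' * E.l)
    rw [r.e.symm_apply_apply, r.e.symm_apply_apply]
    refine (tensor_d_apply _ _ _ _ _ _).trans ?_
    rw [s.d_lo_hi, one_apply_prod, one_apply_of_injective r.e.injective, r.deg_eq,
      Matrix.one_apply_ne (s.e.injective.ne Sum.inl_ne_inr)]
    exact sign_rule_lo_hi _ _ _ _ _ _
  d_hi_hi := by
    rintro ⟨b, b'⟩ ⟨c, c'⟩
    obtain ⟨b, rfl⟩ := r.e.surjective b
    obtain ⟨c, rfl⟩ := r.e.surjective c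
    change (A.tensor X).d (r.e.symm (r.e b), s.e (Sum.inr b'))
        (r.e.symm (r.e c), s.e (Sum.inr c')) * (psign _ (A'.deg (r.e c)).1 * s.sign c') =
      -(psign _ (A'.deg (r.e b)).1 * s.sign b' * (A.tensor X).d
        (r.e.symm (r.e b), s.e (Sum.inl b')) (r.e.symm (r.e c), s.e (Sum.inl c')))
    rw [r.e.symm_apply_apply, r.e.symm_apply_apply, r.deg_eq, r.deg_eq]
    rw [tensor_d_apply A X b c (s.e (Sum.inr b')) (s.e (Sum.inr c')),
      tensor_d_apply A X b c (s.e (Sum.inl b')) (s.e (Sum.inl c'))]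
    have h1 : A.d b c * psign _ (A.deg c).1 = -(psign _ (A.deg b).1 * A.d b c) := by
      have h := congrFun (congrFun (odd_anticomm A.deg A.d A.d_deg) b) c
      rwa [Matrix.mul_diagonal, Matrix.neg_apply, Matrix.diagonal_mul] at h
    have h2 : (1 : Matrix X'.B X'.B (Big I N)) b' c' * s.sign c' =
        (1 : Matrix X'.B X'.B (Big I N)) b' c' * s.sign b' := by
      by_cases h : b' = c'
      · rw [h]
      · rw [Matrix.one_apply_ne h, zero_mul, zero_mul]
    have h3 := s.d_hi_hi b' c'
    have h4 : (1 : Matrix A.B A.B (Big I N)) b c * psign _ (A.deg b).1 =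
        (1 : Matrix A.B A.B (Big I N)) b c * psign _ (A.deg c).1 := by
      by_cases h : b = c
      · rw [h]
      · rw [Matrix.one_apply_ne h, zero_mul, zero_mul]
    rw [s.one_apply_lo, s.one_apply_hi]
    exact sign_rule_hi_hi h1 h2 h3 h4
  del_lo_lo := by
    rintro ⟨b, b'⟩ ⟨c, c'⟩
    obtain ⟨b, rfl⟩ := r.e.surjective b
    obtain ⟨c, rfl⟩ := r.e.surjective c
    change _ = E.ρ ((A.tensor X).del (r.e.symm (r.e b), s.e (Sum.inl b'))
      (r.e.symm (r.e c), s.e (Sum.inl c')))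
    rw [r.e.symm_apply_apply, r.e.symm_apply_apply]
    refine (tensor_del_apply _ _ _ _ _ _).trans (Eq.trans ?_ (congrArg E.ρ
      (tensor_del_apply _ _ _ _ _ _).symm))
    simp only [map_add, map_mul, map_hsign, ← RingHom.coe_coe E.ρ, map_one_apply]
    rw [one_apply_of_injective r.e.injective,
      s.one_apply_lo, r.del_eq, s.del_lo_lo,
      r.hdeg_eq]
    simp only [RingHom.coe_coe]
  del_lo_hi := by
    rintro ⟨b, b'⟩ ⟨c, c'⟩
    refine (tensor_del_apply A X (r.e.symm b) (r.e.symm c) (s.e (Sum.inl b'))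
      (s.e (Sum.inr c'))).trans ?_
    rw [s.del_lo_hi, Matrix.one_apply_ne (s.e.injective.ne Sum.inl_ne_inr), mul_zero, mul_zero,
      add_zero]

end FactComplex

/-! ### The isomorphism of complexes induced by a reduction -/

namespace FactComplex.Reduction

variable {I N N' : Type} {E : Elimination I N N'} {X : FactComplex I N} {X' : FactComplex I N'}
  (s : Reduction E X X')

theorem sign_mul_self (b : X'.B) : s.sign b * s.sign b = 1 := by
  rcases s.sign_eq b with h | h <;> rw [h]
  · exact one_mul _
  · exact (neg_mul_neg (1 : Big I N) 1).trans (one_mul 1)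

theorem sign_mul_homog (b : X'.B) {t : Big I N} {g : Deg} (ht : Homog t g) :
    Homog (s.sign b * t) g := by
  rcases s.sign_eq b with h | h <;> rw [h]
  · rwa [one_mul]
  · exact ht.neg_one_mul

/-- The basis element `lo b` of the `j`-th term. -/
def lo {j : ℤ} (b : X'.BDeg j) : X.BDeg j := ⟨s.e (Sum.inl b.1), (s.hdeg_lo _).trans b.2⟩

/-- The basis element `hi b` of the `j`-th term. -/
def hi {j : ℤ} (b : X'.BDeg j) : X.BDeg j := ⟨s.e (Sum.inr b.1), (s.hdeg_hi _).trans b.2⟩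

/-- The basis of the `j`-th term of `X` consists of two copies of the one of `X'`. -/
noncomputable def degEquiv (j : ℤ) : X'.BDeg j ⊕ X'.BDeg j ≃ X.BDeg j :=
  Equiv.ofBijective (Sum.elim s.lo s.hi) <| by
    constructor
    · rintro (b | b) (c | c) h
      · have h' := s.e.injective (congrArg Subtype.val h)
        exact congrArg Sum.inl (Subtype.ext (Sum.inl_injective h'))
      · exact absurd (s.e.injective (congrArg Subtype.val h)) Sum.inl_ne_inr
      · exact absurd (s.e.injective (congrArg Subtype.val h)) Sum.inr_ne_inl
      · have h' := s.e.injective (congrArg Subtype.val h)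
        exact congrArg Sum.inr (Subtype.ext (Sum.inr_injective h'))
    · rintro ⟨c, hc⟩
      obtain ⟨b | b, rfl⟩ := s.e.surjective c
      · exact ⟨Sum.inl ⟨b, (s.hdeg_lo b).symm.trans hc⟩, rfl⟩
      · exact ⟨Sum.inr ⟨b, (s.hdeg_hi b).symm.trans hc⟩, rfl⟩

theorem degEquiv_symm_lo {j : ℤ} (b : X'.BDeg j) : (s.degEquiv j).symm (s.lo b) = Sum.inl b :=
  (s.degEquiv j).symm_apply_apply (Sum.inl b)

theorem degEquiv_symm_hi {j : ℤ} (b : X'.BDeg j) : (s.degEquiv j).symm (s.hi b) = Sum.inr b :=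
  (s.degEquiv j).symm_apply_apply (Sum.inr b)

theorem forall_bDeg {j : ℤ} {P : X.BDeg j → Prop} (h : ∀ b, P (s.lo b)) (h' : ∀ b, P (s.hi b))
    (c : X.BDeg j) : P c := by
  obtain ⟨b | b, rfl⟩ := (s.degEquiv j).surjective c
  · exact h b
  · exact h' b

theorem neg_sign_rule {A : Type} [CommRing A] {x y p q : A} (h : x * q = -(p * y)) (z : A) :
    x * (q * z) = -p * (y * z) := by
  linear_combination z * h

theorem neg_mul_add_mul_add {A : Type} [CommRing A] (p x y : A) :
    -p * x + (p * x + y) = y := by ring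

theorem block_apply (A : Matrix X.B X.B (Big I N)) {i j : ℤ} (v : X.BDeg i → Big I N)
    (b : X.BDeg j) : X.block A i j v b =
      ∑ c, A b.1 (s.lo c).1 * v (s.lo c) + ∑ c, A b.1 (s.hi c).1 * v (s.hi c) := by
  exact ((s.degEquiv i).sum_comp fun c => A b.1 c.1 * v c).symm.trans (Fintype.sum_sum_type _)

theorem sum_one_mul {j : ℤ} (b : X'.BDeg j) (f : X'.BDeg j → Big I N) :
    ∑ c : X'.BDeg j, (1 : Matrix X'.B X'.B (Big I N)) b.1 c.1 * f c = f b := by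
  rw [Finset.sum_eq_single b]
  · rw [Matrix.one_apply_eq, one_mul]
  · intro c _ hc
    rw [Matrix.one_apply_ne (fun h => hc (Subtype.ext h.symm)), zero_mul]
  · exact fun h => absurd (Finset.mem_univ b) h

/-- The `lo`-components of `d v`. -/
theorem block_d_lo {j : ℤ} (v : X.BDeg j → Big I N) (b : X'.BDeg j) :
    X.block X.d j j v (s.lo b) =
      ∑ c, X.d (s.lo b).1 (s.lo c).1 * v (s.lo c) + s.sign b.1 * E.l * v (s.hi b) := by
  rw [s.block_apply, ← sum_one_mul b fun c => s.sign c.1 * E.l * v (s.hi c)]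
  congr 1
  refine Finset.sum_congr rfl fun c _ => ?_
  rw [← mul_assoc]
  exact congrArg (· * _) (s.d_lo_hi b.1 c.1)

/-- The projection that kills the `hi b` and reduces modulo `l` intertwines a matrix with its
reduction, provided that the block `hi → lo` vanishes modulo `l`. -/
theorem ρ_block {A : Matrix X.B X.B (Big I N)} {A' : Matrix X'.B X'.B (Big I N')} {i j : ℤ}
    (h : ∀ b c, A' b c = E.ρ (A (s.e (Sum.inl b)) (s.e (Sum.inl c))))
    (h' : ∀ b c, E.ρ (A (s.e (Sum.inl b)) (s.e (Sum.inr c))) = 0) (v : X.BDeg i → Big I N)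
    (b : X'.BDeg j) :
    E.ρ (X.block A i j v (s.lo b)) = X'.block A' i j (fun c => E.ρ (v (s.lo c))) b := by
  rw [s.block_apply, map_add, map_sum, map_sum]
  have h0 : ∑ c : X'.BDeg i, E.ρ (A (s.lo b).1 (s.hi c).1 * v (s.hi c)) = 0 :=
    Finset.sum_eq_zero fun c _ => by
      rw [map_mul]
      exact (congrArg (· * _) (h' b.1 c.1)).trans (zero_mul _)
  rw [h0, add_zero]
  refine Finset.sum_congr rfl fun c _ => ?_
  rw [map_mul]
  exact congrArg (· * _) (h b.1 c.1).symm

theorem ρ_d_lo_hi (b c : X'.B) : E.ρ (X.d (s.e (Sum.inl b)) (s.e (Sum.inr c))) = 0 := by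
  rw [s.d_lo_hi, map_mul, map_mul, E.ρ_l, mul_zero, mul_zero]

/-- A homogeneous section of the projection (not a morphism of factorizations). -/
noncomputable def sect (j : ℤ) : (X'.BDeg j → Big I N') →ₗ[Ground I] (X.BDeg j → Big I N) where
  toFun u c :=
    Sum.elim (fun b => E.incl (u b)) (fun _ => 0) ((s.degEquiv j).symm c)
  map_add' u u' := funext fun c => by
    change Sum.elim (fun b => E.incl (u b + u' b)) _ _ = Sum.elim _ _ _ + Sum.elim _ _ _
    rcases (s.degEquiv j).symm c with b | b
    · exact E.incl.map_add _ _
    · exact (add_zero 0).symm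
  map_smul' r u := funext fun c => by
    change Sum.elim (fun b => E.incl (r • u b)) _ _ = r • Sum.elim _ _ _
    rcases (s.degEquiv j).symm c with b | b
    · exact map_smul E.incl _ _
    · exact (smul_zero r).symm

/-- The contracting homotopy on the kernel of the projection: division by `± l`, from the span of the
`lo b` to the span of the `hi b`. -/
noncomputable def homotopy (j : ℤ) : 
    (X.BDeg j → Big I N) →ₗ[Ground I] (X.BDeg j → Big I N) where
  toFun v c :=
    Sum.elim (fun _ => 0) (fun b => s.sign b.1 * E.quot (v (s.lo b))) ((s.degEquiv j).symm c)
  map_add' v v' := funext fun c => by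
    change Sum.elim _ (fun b => s.sign b.1 * E.quot (v (s.lo b) + v' (s.lo b))) _ =
      Sum.elim _ _ _ + Sum.elim _ _ _
    rcases (s.degEquiv j).symm c with b | b
    · exact (add_zero 0).symm
    · change s.sign b.1 * E.quot (v (s.lo b) + v' (s.lo b)) = _ * _ + _ * _
      rw [map_add, mul_add]
  map_smul' r v := funext fun c => by
    change Sum.elim _ (fun b => s.sign b.1 * E.quot (r • v (s.lo b))) _ = r • Sum.elim _ _ _
    rcases (s.degEquiv j).symm c with b | b
    · exact (smul_zero r).symm
    · change s.sign b.1 * E.quot (r • v (s.lo b)) = r • (_ * _)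
      rw [map_smul, mul_smul_comm]

theorem sect_lo {j : ℤ} (u : X'.BDeg j → Big I N') (b : X'.BDeg j) :
    s.sect j u (s.lo b) = E.incl (u b) := by
  change Sum.elim _ _ ((s.degEquiv j).symm (s.lo b)) = _
  rw [degEquiv_symm_lo]; rfl

theorem sect_hi {j : ℤ} (u : X'.BDeg j → Big I N') (b : X'.BDeg j) :
    s.sect j u (s.hi b) = 0 := by
  change Sum.elim _ _ ((s.degEquiv j).symm (s.hi b)) = _
  rw [degEquiv_symm_hi]; rfl

theorem homotopy_lo {j : ℤ} (v : X.BDeg j → Big I N) (b : X'.BDeg j) :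
    s.homotopy j v (s.lo b) = 0 := by
  change Sum.elim _ _ ((s.degEquiv j).symm (s.lo b)) = _
  rw [degEquiv_symm_lo]; rfl

theorem homotopy_hi {j : ℤ} (v : X.BDeg j → Big I N) (b : X'.BDeg j) :
    s.homotopy j v (s.hi b) = s.sign b.1 * E.quot (v (s.lo b)) := by
  change Sum.elim _ _ ((s.degEquiv j).symm (s.hi b)) = _
  rw [degEquiv_symm_hi]; rfl

theorem homotopy_homog {j : ℤ} {g : Deg} {v : X.BDeg j → Big I N}
    (hv : ∀ c, Homog (v c) (g - X.deg c.1)) (c : X.BDeg j) :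
    Homog (s.homotopy j v c) (g - dDeg - X.deg c.1) := by
  revert c
  refine s.forall_bDeg (fun b => ?_) (fun b => ?_)
  · rw [homotopy_lo]; exact Homog.zero _
  · rw [homotopy_hi]
    refine s.sign_mul_homog _ ((E.quot_homog _ _ (hv (s.lo b))).congr ?_)
    have h1 : X.deg (s.lo b).1 = X'.deg b.1 := s.deg_lo b.1
    have h2 : X.deg (s.hi b).1 = X'.deg b.1 + (1, -1, 1) := s.deg_hi b.1
    have h3 : dDeg + (1, -1, 1) = (0, 0, 2) := by decide
    rw [h1, h2, ← h3]
    abel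

theorem sect_homog {j : ℤ} {g : Deg} {u : X'.BDeg j → Big I N'}
    (hu : ∀ b, Homog (u b) (g - X'.deg b.1)) (c : X.BDeg j) :
    Homog (s.sect j u c) (g - X.deg c.1) := by
  revert c
  refine s.forall_bDeg (fun b => ?_) (fun b => ?_)
  · rw [sect_lo]
    exact (E.incl_homog _ _ (hu b)).congr (congrArg _ (s.deg_lo b.1).symm)
  · rw [sect_hi]
    exact Homog.zero _

theorem homotopy_d_lo {j : ℤ} (v : X.BDeg j → Big I N) (hv : ∀ b, E.ρ (v (s.lo b)) = 0)
    (b : X'.BDeg j) : X.block X.d j j (s.homotopy j v) (s.lo b) = v (s.lo b) := by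
  have h0 : ∑ c, X.d (s.lo b).1 (s.lo c).1 * s.homotopy j v (s.lo c) = 0 :=
    Finset.sum_eq_zero fun c _ => by rw [homotopy_lo, mul_zero]
  rw [s.block_d_lo, homotopy_hi, h0, zero_add, mul_mul_mul_comm, sign_mul_self, one_mul,
    E.l_mul_quot _ (hv b)]

theorem d_homotopy_hi {j : ℤ} (v : X.BDeg j → Big I N) (b : X'.BDeg j) :
    X.block X.d j j (s.homotopy j v) (s.hi b) =
      -s.sign b.1 * ∑ c, X.d (s.lo b).1 (s.lo c).1 * E.quot (v (s.lo c)) := by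
  have h0 : ∑ c, X.d (s.hi b).1 (s.lo c).1 * s.homotopy j v (s.lo c) = 0 :=
    Finset.sum_eq_zero fun c _ => by rw [homotopy_lo, mul_zero]
  rw [s.block_apply, h0, zero_add, Finset.mul_sum]
  refine Finset.sum_congr rfl fun c _ => ?_
  rw [homotopy_hi]
  exact neg_sign_rule (s.d_hi_hi b.1 c.1) _

theorem homotopy_d_hi {j : ℤ} (v : X.BDeg j → Big I N) (hv : ∀ b, E.ρ (v (s.lo b)) = 0)
    (b : X'.BDeg j) : s.homotopy j (X.block X.d j j v) (s.hi b) =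
      s.sign b.1 * ∑ c, X.d (s.lo b).1 (s.lo c).1 * E.quot (v (s.lo c)) + v (s.hi b) := by
  have h1 : ∑ c, X.d (s.lo b).1 (s.lo c).1 * v (s.lo c) =
      E.l * ∑ c, X.d (s.lo b).1 (s.lo c).1 * E.quot (v (s.lo c)) := by
    rw [Finset.mul_sum]
    refine Finset.sum_congr rfl fun c _ => ?_
    rw [mul_left_comm, E.l_mul_quot _ (hv c)]
  rw [homotopy_hi, s.block_d_lo, h1, mul_comm (s.sign b.1) E.l, mul_assoc E.l, ← mul_add,
    E.quot_l_mul, mul_add, ← mul_assoc _ _ (v (s.hi b)), sign_mul_self, one_mul]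

/-- On the kernel of the projection, `d H + H d = 1`. -/
theorem homotopy_d {j : ℤ} (v : X.BDeg j → Big I N) (hv : ∀ b, E.ρ (v (s.lo b)) = 0)
    (c : X.BDeg j) :
    X.block X.d j j (s.homotopy j v) c + s.homotopy j (X.block X.d j j v) c = v c := by
  revert c
  refine s.forall_bDeg (fun b => ?_) (fun b => ?_)
  · rw [s.homotopy_d_lo v hv, homotopy_lo, add_zero]
  · rw [s.d_homotopy_hi, s.homotopy_d_hi v hv]
    exact neg_mul_add_mul_add _ _ _

variable {w : Ground I} (hw : X.pot = C w) (hw' : X'.pot = C w)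

/-- The projection of the `j`-th term of `X` onto the one of `X'`: it kills the basis elements
`hi b` and reduces the coefficients of the `lo b` modulo `l`. -/
noncomputable def proj (j : ℤ) : X.term hw j ⟶ X'.term hw' j :=
  ⟨{ toFun := fun (v : X.BDeg j → Big I N) => fun b => E.ρ (v (s.lo b))
     map_add' := fun (_ _ : X.BDeg j → Big I N) => funext fun _ => E.ρ.map_add _ _
     map_smul' := fun _ (_ : X.BDeg j → Big I N) => funext fun _ => map_smul E.ρ _ _ },
    fun _ _ hv b => (E.ρ_homog _ _ (hv (s.lo b))).congr (congrArg _ (s.deg_lo b.1)),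
    fun v => funext fun b => s.ρ_block s.d_lo_lo s.ρ_d_lo_hi v b⟩

theorem proj_comm (i j : ℤ) :
    s.proj hw hw' i ≫ X'.diff hw' i j = X.diff hw i j ≫ s.proj hw hw' j := by
  refine Subtype.ext (LinearMap.ext fun v => funext fun b => Eq.symm ?_)
  change E.ρ (X.block (if i + 1 = j then X.del else 0) i j v (s.lo b)) =
    X'.block (if i + 1 = j then X'.del else 0) i j (fun c => E.ρ (v (s.lo c))) b
  by_cases hij : i + 1 = j
  · rw [if_pos hij, if_pos hij]
    exact s.ρ_block s.del_lo_lo (fun b c => by rw [s.del_lo_hi, map_zero]) v b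
  · rw [if_neg hij, if_neg hij]
    exact s.ρ_block (fun _ _ => (map_zero E.ρ).symm) (fun _ _ => map_zero E.ρ) v b

/-- The projection is an isomorphism in the homotopy category. -/
theorem isIso_proj (j : ℤ) :
    IsIso ((Quotient.functor (MF.homotopic I w)).map (s.proj hw hw' j)) := by
  refine MF.isIso_map_of_contractible_ker _ (s.sect j) (s.homotopy j) ?_ ?_ ?_ ?_ ?_
  · exact fun g u hu => s.sect_homog (j := j) hu
  · exact fun g v hv => s.homotopy_homog (j := j) hv
  · intro u
    exact funext fun b => (congrArg E.ρ (s.sect_lo (j := j) u b)).trans (E.ρ_incl _)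
  · intro v
    exact funext fun b => (congrArg E.ρ (s.homotopy_lo (j := j) v b)).trans (map_zero _)
  · intro v hv
    exact funext (s.homotopy_d v fun b => congrFun hv b)

/-- A reduction induces an isomorphism of complexes over `hmf_w`. -/
noncomputable def isoToComplex : X.toComplex hw ≅ X'.toComplex hw' :=
  HomologicalComplex.Hom.isoOfComponents
    (fun j => @asIso _ _ _ _ ((Quotient.functor (MF.homotopic I w)).map (s.proj hw hw' j))
      (s.isIso_proj hw hw' j))
    fun i j _ => by
      change (Quotient.functor (MF.homotopic I w)).map _ ≫
        (Quotient.functor (MF.homotopic I w)).map _ =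
          (Quotient.functor (MF.homotopic I w)).map _ ≫
            (Quotient.functor (MF.homotopic I w)).map _
      rw [← Functor.map_comp, ← Functor.map_comp, s.proj_comm]

end FactComplex.Reduction

/-! ### Base change of the complexes of crossings and arcs -/

namespace FactComplex

variable {I N N' : Type}

theorem sub_eq_neg_one_mul {A : Type} [CommRing A] (x y : A) : x - y = -1 * (y - x) := by ring

theorem koszulD_map {A A' : Type} [CommRing A] [CommRing A'] (ρ : A →+* A') (p q : A) :
    (koszulD p q).map ρ = koszulD (ρ p) (ρ q) := by
  ext b c
  cases b <;> cases c
  · exact map_zero ρ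
  · rfl
  · rfl
  · exact map_zero ρ

theorem chi0Matrix_map {A A' : Type} [CommRing A] [CommRing A'] (ρ : A →+* A') (x y : A) :
    (chi0Matrix x y).map ρ = chi0Matrix (ρ x) (ρ y) := by
  ext ⟨_ | _, _ | _⟩ ⟨_ | _, _ | _⟩ <;> simp [chi0Matrix]

theorem chi1Matrix_map {A A' : Type} [CommRing A] [CommRing A'] (ρ : A →+* A') (x y : A) :
    (chi1Matrix x y).map ρ = chi1Matrix (ρ x) (ρ y) := by
  ext ⟨_ | _, _ | _⟩ ⟨_ | _, _ | _⟩ <;> simp [chi1Matrix]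

theorem tensorD_map {A A' B B' : Type} [CommRing A] [CommRing A'] [DecidableEq B]
    [DecidableEq B'] (ρ : A →+* A') (deg : B → Deg) (d : Matrix B B A) (d' : Matrix B' B' A) :
    (tensorD deg d d').map ρ = tensorD deg (d.map ρ) (d'.map ρ) := by
  ext b c
  have h : ∀ p, ρ (psign A p) = psign A' p := fun p => by unfold psign; split_ifs <;> simp
  simp only [tensorD, Matrix.map_apply, Matrix.add_apply, Matrix.kroneckerMap_apply, map_add,
    map_mul, map_one_apply, Matrix.diagonal_apply]
  congr 2
  split_ifs
  · exact h _
  · exact map_zero ρ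

/-- Relabelling the corners of a crossing. -/
def _root_.KR.Corners.map (g : I ⊕ N → I ⊕ N') (q : Corners I N) : Corners I N' :=
  ⟨g q.x₁, g q.x₂, g q.x₃, g q.x₄⟩

variable (f : N → I ⊕ N')

theorem gamma0_d_map (q : Corners I N) :
    q.gamma0.d.map (subst f) = (q.map (Sum.elim Sum.inl f)).gamma0.d := by
  refine (tensorD_map (subst f).toRingHom _ _ _).trans ?_
  refine congrArg₂ (tensorD (koszulDeg (-1, 1))) ((koszulD_map _ _ _).trans ?_)
    ((koszulD_map _ _ _).trans ?_) <;>
  · change koszulD (subst f _) (subst f _) = koszulD _ _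
    rw [subst_aVar, map_sub, subst_var, subst_var]
    rfl

theorem gamma1_d_map (q : Corners I N) :
    q.gamma1.d.map (subst f) = (q.map (Sum.elim Sum.inl f)).gamma1.d := by
  refine (tensorD_map (subst f).toRingHom _ _ _).trans ?_
  refine congrArg₂ (tensorD (koszulDeg (-1, 1))) ((koszulD_map _ _ _).trans ?_)
    ((koszulD_map _ _ _).trans ?_)
  · change koszulD (subst f _) (subst f _) = koszulD _ _
    rw [subst_aVar, map_sub, map_sub, map_add, subst_var, subst_var, subst_var, subst_var]
    rfl
  · change koszulD (subst f _) (subst f _) = koszulD _ _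
    rw [map_zero, map_sub, map_mul, map_mul, subst_var, subst_var, subst_var, subst_var]
    rfl

theorem chi0_map (q : Corners I N) :
    q.chi0.map (subst f) = (q.map (Sum.elim Sum.inl f)).chi0 := by
  refine (chi0Matrix_map (subst f).toRingHom _ _).trans ?_
  change chi0Matrix (subst f _) (subst f _) = _
  rw [subst_var, subst_var]
  rfl

theorem chi1_map (q : Corners I N) :
    q.chi1.map (subst f) = (q.map (Sum.elim Sum.inl f)).chi1 := by
  refine (chi1Matrix_map (subst f).toRingHom _ _).trans ?_
  change chi1Matrix (subst f _) (subst f _) = _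
  rw [subst_var, subst_var]
  rfl

/-- Base change of the complex of a positive crossing. -/
def BaseChange.positive (q : Corners I N) : BaseChange (subst f) q.positiveComplex
    (q.map (Sum.elim Sum.inl f)).positiveComplex where
  e := Equiv.refl ((Bool × Bool) ⊕ (Bool × Bool))
  hdeg_eq := by rintro (b | b) <;> rfl
  deg_eq := by rintro (b | b) <;> rfl
  d_eq := by
    rintro (b | b) (c | c)
    · exact (congrFun (congrFun (gamma0_d_map f q) b) c).symm
    · exact (map_zero (subst f)).symm
    · exact (map_zero (subst f)).symm
    · exact (congrFun (congrFun (gamma1_d_map f q) b) c).symm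
  del_eq := by
    rintro (b | b) (c | c)
    · exact (map_zero (subst f)).symm
    · exact (map_zero (subst f)).symm
    · exact (congrFun (congrFun (chi0_map f q) b) c).symm
    · exact (map_zero (subst f)).symm

/-- Base change of the complex of a negative crossing. -/
def BaseChange.negative (q : Corners I N) : BaseChange (subst f) q.negativeComplex
    (q.map (Sum.elim Sum.inl f)).negativeComplex where
  e := Equiv.refl ((Bool × Bool) ⊕ (Bool × Bool))
  hdeg_eq := by rintro (b | b) <;> rfl
  deg_eq := by rintro (b | b) <;> rfl
  d_eq := by
    rintro (b | b) (c | c)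
    · exact (congrFun (congrFun (gamma1_d_map f q) b) c).symm
    · exact (map_zero (subst f)).symm
    · exact (map_zero (subst f)).symm
    · exact (congrFun (congrFun (gamma0_d_map f q) b) c).symm
  del_eq := by
    rintro (b | b) (c | c)
    · exact (map_zero (subst f)).symm
    · exact (map_zero (subst f)).symm
    · exact (congrFun (congrFun (chi1_map f q) b) c).symm
    · exact (map_zero (subst f)).symm

/-- Base change of the factorization of an arc. -/
def BaseChange.arc (p r : I ⊕ N) : BaseChange (subst f) (single (KR.arc p r))
    (single (KR.arc (Sum.elim Sum.inl f p) (Sum.elim Sum.inl f r))) where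
  e := Equiv.refl Bool
  hdeg_eq _ := rfl
  deg_eq _ := rfl
  d_eq b c := by
    have h : (koszulD aVar (var r - var p)).map (subst f) =
        koszulD aVar (var (Sum.elim Sum.inl f r) - var (Sum.elim Sum.inl f p)) := by
      refine (koszulD_map (subst f).toRingHom _ _).trans ?_
      change koszulD (subst f _) (subst f _) = _
      rw [subst_aVar, map_sub, subst_var, subst_var]
    exact (congrFun (congrFun h b) c).symm
  del_eq _ _ := (map_zero (subst f)).symm

/-- Base change of the unit. -/
def BaseChange.unit (ρ : Big I N →ₐ[Ground I] Big I N') : BaseChange ρ unit unit where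
  e := Equiv.refl Unit
  hdeg_eq _ := rfl
  deg_eq _ := rfl
  d_eq _ _ := (map_zero ρ).symm
  del_eq _ _ := (map_zero ρ).symm

theorem BaseChange.nonempty_tensorList {ρ : Big I N →ₐ[Ground I] Big I N'}
    {l : List (FactComplex I N)} {l' : List (FactComplex I N')}
    (h : List.Forall₂ (fun X X' => Nonempty (BaseChange ρ X X')) l l') :
    Nonempty (BaseChange ρ (tensorList l) (tensorList l')) := by
  induction h with
  | nil => exact ⟨BaseChange.unit ρ⟩
  | cons h _ ih => exact h.elim fun r => ih.elim fun s => ⟨r.tensor s⟩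

/-- In a tensor product, the factor of an arc with linear form `± l` disappears at the cost of
reducing the other factors modulo `l`. The position of the factor does not matter. -/
theorem Reduction.nonempty_tensorList {E : Elimination I N N'} (p r : I ⊕ N) (ε : Big I N)
    (hε : ε = 1 ∨ ε = -1) (h : var r - var p = ε * E.l) {l₁ l₂ : List (FactComplex I N)}
    {l₁' l₂' : List (FactComplex I N')}
    (h₁ : List.Forall₂ (fun X X' => Nonempty (BaseChange E.ρ X X')) l₁ l₁')
    (h₂ : List.Forall₂ (fun X X' => Nonempty (BaseChange E.ρ X X')) l₂ l₂') :
    Nonempty (Reduction E (tensorList (l₁ ++ single (KR.arc p r) :: l₂))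
      (tensorList (l₁' ++ l₂'))) := by
  induction h₁ with
  | nil => exact (BaseChange.nonempty_tensorList h₂).elim fun s => ⟨Reduction.arc E p r ε hε h s⟩
  | cons h _ ih => exact h.elim fun r => ih.elim fun s => ⟨Reduction.tensor r s⟩

end FactComplex

namespace TangleDiagram.Marking

open FactComplex

variable {D : TangleDiagram}

/-- If the arcs of `m'` are obtained from those of `m` by deleting the arc from `p` to `r` and then
identifying the mark `z ∈ {p, r}` with the other end of that arc, then the two complexes are
isomorphic. -/
theorem nonempty_iso_of_arcs (m m' : D.Marking) (f : m.Mark → m'.Label) (j : m'.Mark → m.Mark)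
    (hf : ∀ n, f (j n) = Sum.inr n) (z : m.Mark) (hz : ∀ n, n ≠ z → ∃ n', j n' = n)
    (y : m.Label) (hy : y ≠ Sum.inr z) (hzy : f z = Sum.elim Sum.inl f y) (p r : m.Label)
    (hpr : p = y ∧ r = Sum.inr z ∨ p = Sum.inr z ∧ r = y) (A B : List (m.Label × m.Label))
    (h : m.arcs = A ++ (p, r) :: B)
    (h' : m'.arcs = (A ++ B).map (Prod.map (Sum.elim Sum.inl f) (Sum.elim Sum.inl f)))
    (hcorners : ∀ q, m'.corners q = (m.corners q).map (Sum.elim Sum.inl f)) :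
    Nonempty (m.complex ≅ m'.complex) := by
  obtain ⟨E, hρ, hl⟩ := Elimination.exists_of_ne f j hf z hz y hy hzy
  have hε : ∃ ε : Big D.Bd m.Mark, (ε = 1 ∨ ε = -1) ∧ var r - var p = ε * E.l := by
    rcases hpr with ⟨rfl, rfl⟩ | ⟨rfl, rfl⟩
    · exact ⟨1, Or.inl rfl, by rw [hl, one_mul]; rfl⟩
    · exact ⟨-1, Or.inr rfl, by rw [hl]; exact sub_eq_neg_one_mul _ _⟩
  obtain ⟨ε, hε, hpr⟩ := hε
  have hc : List.Forall₂ (fun X X' => Nonempty (BaseChange E.ρ X X'))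
      ((Finset.univ : Finset D.Crossing).toList.map m.crossingComplex)
      ((Finset.univ : Finset D.Crossing).toList.map m'.crossingComplex) := by
    rw [List.forall₂_map_left_iff, List.forall₂_map_right_iff, List.forall₂_same]
    intro q _
    rw [hρ]
    unfold crossingComplex
    rw [hcorners]
    cases D.positive q
    · exact ⟨BaseChange.negative f _⟩
    · exact ⟨BaseChange.positive f _⟩
  have ha : ∀ l : List (m.Label × m.Label),
      List.Forall₂ (fun X X' => Nonempty (BaseChange E.ρ X X'))
      (l.map fun c => FactComplex.single (arc c.1 c.2))
      ((l.map (Prod.map (Sum.elim Sum.inl f) (Sum.elim Sum.inl f))).map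
        fun c => FactComplex.single (arc c.1 c.2)) := fun l => by
    rw [List.map_map, List.forall₂_map_left_iff, List.forall₂_map_right_iff, List.forall₂_same]
    intro c _
    rw [hρ]
    exact ⟨BaseChange.arc f c.1 c.2⟩
  obtain ⟨s⟩ : Nonempty (Reduction E m.bigComplex m'.bigComplex) := by
    have s := Reduction.nonempty_tensorList p r ε hε hpr (List.rel_append hc (ha A)) (ha B)
    unfold bigComplex
    rw [h, h', List.map_append, List.map_append, List.map_append, List.map_cons,
      ← List.append_assoc, ← List.append_assoc]
    exact s
  exact ⟨(HomotopyCategory.quotient _ _).mapIso (s.isoToComplex m.bigComplex_pot m'.bigComplex_pot)⟩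

end TangleDiagram.Marking

/-! ### Lists of labels and arcs -/

section Lists

variable {L L' : Type}

theorem zip_tail_append_cons (x : L) (l₂ : List L) : ∀ l₁ : List L,
    (l₁ ++ x :: l₂).zip (l₁ ++ x :: l₂).tail =
      (l₁ ++ [x]).zip (l₁ ++ [x]).tail ++ (x :: l₂).zip l₂
  | [] => by simp
  | [a] => by simp
  | a :: b :: l₁ => by
    have ih := zip_tail_append_cons x l₂ (b :: l₁)
    simp only [List.cons_append, List.tail_cons, List.zip_cons_cons, List.cons.injEq,
      true_and] at ih ⊢
    exact ih

/-- Deleting one of two neighbours on a path deletes the arc between them. -/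
theorem exists_zip_tail_eq (g : L → L') {p r : L} (hg : g p = g r) (l₁ l₂ : List L) :
    ∃ A B, (l₁ ++ p :: r :: l₂).zip (l₁ ++ p :: r :: l₂).tail = A ++ (p, r) :: B ∧
      ((l₁ ++ p :: l₂).map g).zip ((l₁ ++ p :: l₂).map g).tail =
        (A ++ B).map (Prod.map g g) := by
  refine ⟨(l₁ ++ [p]).zip (l₁ ++ [p]).tail, (r :: l₂).zip l₂, zip_tail_append_cons _ _ _, ?_⟩
  rw [← List.map_tail, List.zip_map, zip_tail_append_cons, List.map_append, List.map_append]
  congr 1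
  rw [← List.zip_map, ← List.zip_map, List.map_cons, List.map_cons, hg]

theorem zip_rotate_one (a : L) (l : List L) :
    (a :: l).zip ((a :: l).rotate 1) = (a :: l ++ [a]).zip (a :: l ++ [a]).tail := by
  have h := List.zip_append (l₁ := a :: l) (r₁ := [a]) (l₂ := l ++ [a]) (r₂ := []) (by simp)
  rw [List.append_nil, List.zip_nil_right, List.append_nil] at h
  rw [List.rotate_cons_succ, List.rotate_zero, ← h]
  rfl

/-- Deleting one of two neighbours on a cycle deletes the arc between them. -/
theorem exists_zip_rotate_eq (g : L → L') {p r : L} (hg : g p = g r) (l₁ l₂ : List L) :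
    ∃ A B, (l₁ ++ p :: r :: l₂).zip ((l₁ ++ p :: r :: l₂).rotate 1) = A ++ (p, r) :: B ∧
      ((l₁ ++ p :: l₂).map g).zip (((l₁ ++ p :: l₂).map g).rotate 1) =
        (A ++ B).map (Prod.map g g) := by
  -- the path obtained from the cycle by repeating the first label at the end
  rcases l₁ with _ | ⟨a, l₁⟩
  · obtain ⟨A, B, h, h'⟩ := exists_zip_tail_eq g hg [] (l₂ ++ [p])
    refine ⟨A, B, ?_, ?_⟩
    · rw [← h]
      exact zip_rotate_one p (r :: l₂)
    · rw [← h']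
      simpa using zip_rotate_one (g p) (l₂.map g)
  · obtain ⟨A, B, h, h'⟩ := exists_zip_tail_eq g hg (a :: l₁) (l₂ ++ [a])
    refine ⟨A, B, ?_, ?_⟩
    · rw [← h]
      simpa using zip_rotate_one a (l₁ ++ p :: r :: l₂)
    · rw [← h']
      simpa using zip_rotate_one (g a) ((l₁ ++ p :: l₂).map g)

theorem filter_ne_eq_self [DecidableEq L] {l : List L} {z : L} (h : z ∉ l) :
    l.filter (· ≠ z) = l :=
  List.filter_eq_self.mpr fun _ hx => decide_eq_true fun hxz => h (hxz ▸ hx)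

/-- An element of a list that has other elements has a neighbour. -/
theorem exists_neighbour [DecidableEq L] {l : List L} (hl : l.Nodup) {z : L} (hz : z ∈ l)
    (h : l.filter (· ≠ z) ≠ []) :
    ∃ l₁ p r l₂ y, l = l₁ ++ p :: r :: l₂ ∧ l.filter (· ≠ z) = l₁ ++ y :: l₂ ∧ y ≠ z ∧
      (p = y ∧ r = z ∨ p = z ∧ r = y) := by
  obtain ⟨s, t, rfl⟩ := List.append_of_mem hz
  have hs : z ∉ s := fun hs => (List.nodup_append.mp hl).2.2 z hs z (by simp) rfl
  have ht : z ∉ t := (List.nodup_cons.mp (List.nodup_append.mp hl).2.1).1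
  have hf : (s ++ z :: t).filter (· ≠ z) = s ++ t := by
    rw [List.filter_append, List.filter_cons_of_neg (by simp), filter_ne_eq_self hs,
      filter_ne_eq_self ht]
  rw [hf] at h ⊢
  rcases t with _ | ⟨y, t⟩
  · obtain ⟨s, y, rfl⟩ : ∃ s' y, s = s' ++ [y] := by
      rw [List.append_nil] at h
      exact ⟨s.dropLast, s.getLast h, (List.dropLast_append_getLast h).symm⟩
    exact ⟨s, y, z, [], y, by simp, by simp, fun h => hs (by simp [h]), Or.inl ⟨rfl, rfl⟩⟩
  · exact ⟨s, z, y, t, y, rfl, rfl, fun h => ht (by simp [h]), Or.inr ⟨rfl, rfl⟩⟩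

/-- If deleting an entry changes the list attached to a single index `k`, then it changes the
concatenation in the same way. -/
theorem exists_flatMap_eq {κ M M' : Type} (g : M → M') {F : κ → List M} {F' : κ → List M'}
    {l : List κ} (hl : l.Nodup) {k : κ} (hk : k ∈ l) {A B : List M} {c : M}
    (hF : F k = A ++ c :: B) (hF' : F' k = (A ++ B).map g)
    (h : ∀ i, i ≠ k → F' i = (F i).map g) :
    ∃ A B, l.flatMap F = A ++ c :: B ∧ l.flatMap F' = (A ++ B).map g := by
  obtain ⟨s, t, rfl⟩ := List.append_of_mem hk
  have hs : k ∉ s := fun hs => (List.nodup_append.mp hl).2.2 k hs k (by simp) rfl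
  have ht : k ∉ t := (List.nodup_cons.mp (List.nodup_append.mp hl).2.1).1
  have h' : ∀ u : List κ, k ∉ u → u.flatMap F' = (u.flatMap F).map g := fun u hu => by
    rw [List.map_flatMap]
    exact List.flatMap_congr fun i hi => h i (by rintro rfl; exact hu hi)
  refine ⟨s.flatMap F ++ A, B ++ t.flatMap F, ?_, ?_⟩
  · simp [hF]
  · rw [List.flatMap_append, List.flatMap_cons, h' s hs, h' t ht, hF']
    simp

theorem sort_subtype_map {s s' : Finset ℝ} (h : s' ⊆ s) :
    (Finset.univ : Finset {t // t ∈ s'}).sort.map (fun t => (⟨t.1, h t.2⟩ : {t // t ∈ s})) =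
      (Finset.univ : Finset {t // t ∈ s}).sort.filter (fun t => t.1 ∈ s') := by
  refine List.SortedLT.eq_of_mem_iff ?_ ?_ ?_
  · refine List.Pairwise.sortedLT (List.pairwise_map.mpr ?_)
    exact (Finset.sortedLT_sort (Finset.univ : Finset {t // t ∈ s'})).pairwise
  · refine List.Pairwise.sortedLT (List.Pairwise.filter _ ?_)
    exact (Finset.sortedLT_sort (Finset.univ : Finset {t // t ∈ s})).pairwise
  · rintro ⟨t, ht⟩
    simp

/-- Passing to a subset of the marks filters the sorted list of their labels. -/
theorem map_sort_eq_filter {s s' : Finset ℝ} (h : s' ⊆ s) (i : {t // t ∈ s} → L)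
    (i' : {t // t ∈ s'} → L') (J : L' → L) (hJ : ∀ t, J (i' t) = i ⟨t.1, h t.2⟩) (P : L → Prop)
    [DecidablePred P] (hP : ∀ t, P (i t) ↔ t.1 ∈ s') :
    ((Finset.univ : Finset {t // t ∈ s'}).sort.map i').map J =
      ((Finset.univ : Finset {t // t ∈ s}).sort.map i).filter (fun x => decide (P x)) := by
  have hP' : (fun x => decide (P x)) ∘ i = fun t => decide (t.1 ∈ s') :=
    funext fun t => decide_eq_decide.mpr (hP t)
  rw [List.filter_map, hP', ← sort_subtype_map h, List.map_map, List.map_map]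
  exact List.map_congr_left fun t _ => hJ t

end Lists

/-! ### Removing marks -/

namespace TangleDiagram.Marking

variable {D : TangleDiagram}

/-- The marks of `m'` are among the marks of `m`. -/
def Subset (m' m : D.Marking) : Prop :=
  (∀ e, m'.edgeMarks e ⊆ m.edgeMarks e) ∧ ∀ c, m'.circleMarks c ⊆ m.circleMarks c

/-- The inclusion of marks. -/
def Subset.incl {m' m : D.Marking} (h : m'.Subset m) : m'.Mark → m.Mark :=
  Sum.map (fun x => ⟨x.1, x.2.1, h.1 _ x.2.2⟩) (fun x => ⟨x.1, x.2.1, h.2 _ x.2.2⟩)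

theorem Subset.incl_injective {m' m : D.Marking} (h : m'.Subset m) :
    Function.Injective h.incl := by
  refine Function.Injective.sumMap ?_ ?_ <;>
  · rintro ⟨e, t, ht⟩ ⟨e', t', ht'⟩ heq
    obtain ⟨rfl, heq⟩ := Sigma.mk.inj_iff.mp heq
    obtain rfl := congrArg Subtype.val (eq_of_heq heq)
    rfl

theorem circleLabels_ne_nil (m : D.Marking) (c : D.Circle) : m.circleLabels c ≠ [] := by
  obtain ⟨t, ht⟩ := m.circle_nonempty c
  refine List.ne_nil_of_mem (a := Sum.inr (Sum.inr ⟨c, t, ht⟩)) ?_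
  simp [circleLabels]

theorem edgeLabels_nodup (m : D.Marking) (e : D.Edge) : (m.edgeLabels e).Nodup := by
  have h : ((Finset.univ : Finset {t : ℝ // t ∈ m.edgeMarks e}).sort.map
      fun t => (Sum.inr (Sum.inl ⟨e, t⟩) : m.Label)).Nodup :=
    (Finset.sort_nodup _ _).map fun t t' h => by simpa using h
  unfold edgeLabels
  rcases e with s | p <;> rcases D.edgeEnd _ with t | t <;> simpa [List.nodup_append] using h

theorem circleLabels_nodup (m : D.Marking) (c : D.Circle) : (m.circleLabels c).Nodup :=
  (Finset.sort_nodup _ _).map fun t t' h => by simpa using h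

theorem mem_edgeLabels_mark {m : D.Marking} {e : D.Edge} {x : m.Mark} :
    (Sum.inr x : m.Label) ∈ m.edgeLabels e ↔ ∃ t, x = Sum.inl ⟨e, t⟩ := by
  unfold edgeLabels
  rcases e with s | p <;> rcases D.edgeEnd _ with t | t <;> simp [eq_comm]

theorem mem_circleLabels_mark {m : D.Marking} {c : D.Circle} {x : m.Mark} :
    (Sum.inr x : m.Label) ∈ m.circleLabels c ↔ ∃ t, x = Sum.inr ⟨c, t⟩ := by
  simp [circleLabels, eq_comm]

section Incl

variable {m' m : D.Marking} (h : m'.Subset m)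

theorem Subset.exists_incl_eq_inl {e : D.Edge} {t : {t // t ∈ m.edgeMarks e}} :
    (∃ n, h.incl n = Sum.inl ⟨e, t⟩) ↔ t.1 ∈ m'.edgeMarks e := by
  constructor
  · rintro ⟨⟨e', t', ht'⟩ | x, hx⟩
    · obtain ⟨rfl, hx⟩ := Sigma.mk.inj_iff.mp (Sum.inl_injective hx)
      rwa [← congrArg Subtype.val (eq_of_heq hx)]
    · exact absurd hx Sum.inr_ne_inl
  · exact fun ht => ⟨Sum.inl ⟨e, t.1, ht⟩, rfl⟩

theorem Subset.exists_incl_eq_inr {c : D.Circle} {t : {t // t ∈ m.circleMarks c}} :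
    (∃ n, h.incl n = Sum.inr ⟨c, t⟩) ↔ t.1 ∈ m'.circleMarks c := by
  constructor
  · rintro ⟨x | ⟨c', t', ht'⟩, hx⟩
    · exact absurd hx Sum.inl_ne_inr
    · obtain ⟨rfl, hx⟩ := Sigma.mk.inj_iff.mp (Sum.inr_injective hx)
      rwa [← congrArg Subtype.val (eq_of_heq hx)]
  · exact fun ht => ⟨Sum.inr ⟨c, t.1, ht⟩, rfl⟩

/-- The labels of the smaller marking on an edge are those of the larger one that survive, in the
same order. -/
theorem Subset.map_edgeLabels [DecidableEq m.Label] {z : m.Mark} (hz : ∀ n, n ≠ z ↔ ∃ n', h.incl n' = n) (e : D.Edge) :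
    (m'.edgeLabels e).map (Sum.map id h.incl) =
      (m.edgeLabels e).filter (· ≠ Sum.inr z) := by
  have hm : ((Finset.univ : Finset {t : ℝ // t ∈ m'.edgeMarks e}).sort.map
      fun t => (Sum.inr (Sum.inl ⟨e, t⟩) : m'.Label)).map (Sum.map id h.incl) =
      ((Finset.univ : Finset {t : ℝ // t ∈ m.edgeMarks e}).sort.map
        fun t => (Sum.inr (Sum.inl ⟨e, t⟩) : m.Label)).filter (· ≠ Sum.inr z) := by
    refine map_sort_eq_filter (h.1 e) (fun t => (Sum.inr (Sum.inl ⟨e, t⟩) : m.Label))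
      (fun t => (Sum.inr (Sum.inl ⟨e, t⟩) : m'.Label)) (Sum.map id h.incl) (fun _ => rfl)
      (fun x : m.Label => x ≠ Sum.inr z) fun t => ?_
    rw [ne_eq, Sum.inr.injEq, ← ne_eq, hz, h.exists_incl_eq_inl]
  unfold edgeLabels
  rw [List.map_append, List.map_append, List.filter_append, List.filter_append, hm]
  congr 1
  · congr 1
    rcases e with s | p <;> simp
  · rcases D.edgeEnd _ with t | t <;> simp

/-- The labels of the smaller marking on a circle are those of the larger one that survive, in the
same cyclic order. -/
theorem Subset.map_circleLabels [DecidableEq m.Label] {z : m.Mark} (hz : ∀ n, n ≠ z ↔ ∃ n', h.incl n' = n)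
    (c : D.Circle) :
    (m'.circleLabels c).map (Sum.map id h.incl) =
      (m.circleLabels c).filter (· ≠ Sum.inr z) := by
  refine map_sort_eq_filter (h.2 c) (fun t => (Sum.inr (Sum.inr ⟨c, t⟩) : m.Label))
    (fun t => (Sum.inr (Sum.inr ⟨c, t⟩) : m'.Label)) (Sum.map id h.incl) (fun _ => rfl)
    (fun x : m.Label => x ≠ Sum.inr z) fun t => ?_
  rw [ne_eq, Sum.inr.injEq, ← ne_eq, hz, h.exists_incl_eq_inr]

end Incl

theorem elim_map_incl {m' m : D.Marking} (h : m'.Subset m) (f : m.Mark → m'.Label)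
    (hf : ∀ n, f (h.incl n) = Sum.inr n) (x : m'.Label) :
    Sum.elim Sum.inl f (Sum.map id h.incl x) = x := by
  rcases x with b | n
  · rfl
  · exact hf n

theorem map_elim_map_incl {m' m : D.Marking} (h : m'.Subset m) (f : m.Mark → m'.Label)
    (hf : ∀ n, f (h.incl n) = Sum.inr n) (l : List m'.Label) :
    (l.map (Sum.map id h.incl)).map (Sum.elim Sum.inl f) = l := by
  rw [List.map_map]
  exact List.map_id'' (elim_map_incl h f hf) l

theorem firstLabel_eq {m m' : D.Marking} (g : m.Label → m'.Label) (e : D.Edge)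
    (h : (m'.edgeLabels e).head? = (m.edgeLabels e).head?.map g) :
    m'.firstLabel e = g (m.firstLabel e) := by
  rw [List.head?_eq_some_head (m'.edgeLabels_ne_nil e),
    List.head?_eq_some_head (m.edgeLabels_ne_nil e)] at h
  exact Option.some_injective _ h

theorem lastLabel_eq {m m' : D.Marking} (g : m.Label → m'.Label) (e : D.Edge)
    (h : (m'.edgeLabels e).getLast? = (m.edgeLabels e).getLast?.map g) :
    m'.lastLabel e = g (m.lastLabel e) := by
  rw [List.getLast?_eq_some_getLast (m'.edgeLabels_ne_nil e),
    List.getLast?_eq_some_getLast (m.edgeLabels_ne_nil e)] at h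
  exact Option.some_injective _ h

/-- If the strand with labels `L` carries the mark `z` and other labels, then `z` has a neighbour `y`
on it; the map of labels that identifies `z` with `y` merges the ends `p` and `r` of the arc between
them. -/
theorem exists_identification {m' m : D.Marking} (h : m'.Subset m) {z : m.Mark}
    (hz : ∀ n, n ≠ z ↔ ∃ n', h.incl n' = n) {L : List m.Label} {L' : List m'.Label}
    (hL : L.Nodup) (hzL : Sum.inr z ∈ L) (hL' : L' ≠ [])
    (hLL' : ∀ [DecidableEq m.Label], L'.map (Sum.map id h.incl) = L.filter (· ≠ Sum.inr z)) :
    ∃ (l₁ : List m.Label) (p r : m.Label) (l₂ : List m.Label) (y : m.Label)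
      (f : m.Mark → m'.Label), L = l₁ ++ p :: r :: l₂ ∧
      L' = (l₁ ++ p :: l₂).map (Sum.elim Sum.inl f) ∧ y ≠ Sum.inr z ∧
      (p = y ∧ r = Sum.inr z ∨ p = Sum.inr z ∧ r = y) ∧ (∀ n, f (h.incl n) = Sum.inr n) ∧
      f z = Sum.elim Sum.inl f y := by
  classical
  obtain ⟨l₁, p, r, l₂, y, hl, hl', hy, hpr⟩ := exists_neighbour hL hzL (by
    rw [← hLL']
    simpa using hL')
  obtain ⟨y', hy'⟩ : ∃ y' : m'.Label, Sum.map id h.incl y' = y := by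
    rcases y with b | n
    · exact ⟨Sum.inl b, rfl⟩
    · obtain ⟨n', rfl⟩ := (hz n).mp fun hn => hy (congrArg Sum.inr hn)
      exact ⟨Sum.inr n', rfl⟩
  let f : m.Mark → m'.Label := fun n =>
    if hn : ∃ n', h.incl n' = n then Sum.inr hn.choose else y'
  have hf : ∀ n, f (h.incl n) = Sum.inr n := fun n => by
    have hn : ∃ n', h.incl n' = h.incl n := ⟨n, rfl⟩
    exact (dif_pos hn).trans (congrArg Sum.inr (h.incl_injective hn.choose_spec))
  have hg := elim_map_incl h f hf
  have hfz : f z = Sum.elim Sum.inl f y := by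
    rw [← hy', hg]
    exact dif_neg fun hn => (hz z).mpr hn rfl
  have hyp : Sum.elim Sum.inl f y = Sum.elim Sum.inl f p := by
    rcases hpr with ⟨rfl, rfl⟩ | ⟨rfl, rfl⟩
    · rfl
    · exact hfz.symm
  refine ⟨l₁, p, r, l₂, y, f, hl, ?_, hy, hpr, hf, hfz⟩
  rw [← map_elim_map_incl h f hf L', hLL', hl', List.map_append, List.map_append, List.map_cons,
    List.map_cons, hyp]

/-- Removing a single mark does not change the complex. -/
theorem nonempty_iso_of_remove_one {m' m : D.Marking} (h : m'.Subset m) (z : m.Mark)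
    (hz : ∀ n, n ≠ z ↔ ∃ n', h.incl n' = n) : Nonempty (m.complex ≅ m'.complex) := by
  classical
  -- strands without the mark `z` keep their labels
  have hE : ∀ f : m.Mark → m'.Label, (∀ n, f (h.incl n) = Sum.inr n) → ∀ e,
      Sum.inr z ∉ m.edgeLabels e →
      m'.edgeLabels e = (m.edgeLabels e).map (Sum.elim Sum.inl f) := fun f hf e he => by
    rw [← map_elim_map_incl h f hf (m'.edgeLabels e), h.map_edgeLabels hz,
      filter_ne_eq_self he]
  have hC : ∀ f : m.Mark → m'.Label, (∀ n, f (h.incl n) = Sum.inr n) → ∀ c,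
      Sum.inr z ∉ m.circleLabels c →
      m'.circleLabels c = (m.circleLabels c).map (Sum.elim Sum.inl f) := fun f hf c hc => by
    rw [← map_elim_map_incl h f hf (m'.circleLabels c), h.map_circleLabels hz,
      filter_ne_eq_self hc]
  have arcsE : ∀ (f : m.Mark → m'.Label) (e : D.Edge),
      m'.edgeLabels e = (m.edgeLabels e).map (Sum.elim Sum.inl f) → m'.edgeArcs e =
        (m.edgeArcs e).map (Prod.map (Sum.elim Sum.inl f) (Sum.elim Sum.inl f)) := fun f e he => by
    rw [edgeArcs, edgeArcs, he, ← List.map_tail, List.zip_map]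
  have arcsC : ∀ (f : m.Mark → m'.Label) (c : D.Circle),
      m'.circleLabels c = (m.circleLabels c).map (Sum.elim Sum.inl f) → m'.circleArcs c =
        (m.circleArcs c).map (Prod.map (Sum.elim Sum.inl f) (Sum.elim Sum.inl f)) :=
    fun f c hc => by rw [circleArcs, circleArcs, hc, ← List.map_rotate, List.zip_map]
  have hmerge : ∀ (f : m.Mark → m'.Label) (p r y : m.Label),
      (p = y ∧ r = Sum.inr z ∨ p = Sum.inr z ∧ r = y) → f z = Sum.elim Sum.inl f y →
        Sum.elim Sum.inl f p = Sum.elim Sum.inl f r := by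
    rintro f p r y (⟨rfl, rfl⟩ | ⟨rfl, rfl⟩) hf
    · exact hf.symm
    · exact hf
  rcases z with ⟨e₀, t⟩ | ⟨c₀, t⟩
  · have hz' : ∀ e, e ≠ e₀ → Sum.inr (Sum.inl ⟨e₀, t⟩) ∉ m.edgeLabels e := fun e he h' => by
      obtain ⟨t', ht'⟩ := mem_edgeLabels_mark.mp h'
      exact he (Sigma.mk.inj_iff.mp (Sum.inl_injective ht')).1.symm
    have hz'' : ∀ c, Sum.inr (Sum.inl ⟨e₀, t⟩) ∉ m.circleLabels c := fun c h' => by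
      obtain ⟨t', ht'⟩ := mem_circleLabels_mark.mp h'
      exact Sum.inl_ne_inr ht'
    obtain ⟨l₁, p, r, l₂, y, f, hl, hl', hy, hpr, hf, hfz⟩ := exists_identification h hz
      (m.edgeLabels_nodup e₀) (mem_edgeLabels_mark.mpr ⟨t, rfl⟩) (m'.edgeLabels_ne_nil e₀)
      (h.map_edgeLabels hz e₀)
    have hpr' := hmerge f p r y hpr hfz
    have hr : (l₁ ++ p :: l₂).map (Sum.elim Sum.inl f) =
        (l₁ ++ r :: l₂).map (Sum.elim Sum.inl f) := by
      rw [List.map_append, List.map_append, List.map_cons, List.map_cons, hpr']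
    have hfirst : ∀ e, m'.firstLabel e = Sum.elim Sum.inl f (m.firstLabel e) := fun e => by
      apply firstLabel_eq
      by_cases he : e = e₀
      · rw [he, hl', hl]
        cases l₁ <;> simp
      · rw [hE f hf e (hz' e he), List.head?_map]
    have hlast : ∀ e, m'.lastLabel e = Sum.elim Sum.inl f (m.lastLabel e) := fun e => by
      apply lastLabel_eq
      by_cases he : e = e₀
      · rw [he, hl', hl, hr, List.getLast?_map]
        simp
      · rw [hE f hf e (hz' e he), List.getLast?_map]
    obtain ⟨A, B, hA, hA'⟩ := exists_zip_tail_eq (Sum.elim Sum.inl f) hpr' l₁ l₂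
    obtain ⟨A', B', hB, hB'⟩ := exists_flatMap_eq _
      (Finset.nodup_toList (Finset.univ : Finset D.Edge)) (k := e₀) (by simp)
      (F := m.edgeArcs) (F' := m'.edgeArcs) (by rw [edgeArcs, hl, hA])
      (by rw [edgeArcs, hl', hA']) (fun e he => arcsE f e (hE f hf e (hz' e he)))
    refine nonempty_iso_of_arcs m m' f h.incl hf _ (fun n hn => (hz n).mp hn) y hy hfz p r hpr A'
      (B' ++ (Finset.univ : Finset D.Circle).toList.flatMap m.circleArcs) ?_ ?_ ?_
    · rw [arcs, hB, List.append_assoc, List.cons_append]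
    · have hC' := funext fun c => arcsC f c (hC f hf c (hz'' c))
      rw [arcs, hB', ← List.append_assoc, List.map_append (l₁ := A' ++ B'), List.map_flatMap,
        hC']
    · intro q
      simp only [corners, Corners.map, hfirst, hlast]
  · have hz' : ∀ c, c ≠ c₀ → Sum.inr (Sum.inr ⟨c₀, t⟩) ∉ m.circleLabels c := fun c hc h' => by
      obtain ⟨t', ht'⟩ := mem_circleLabels_mark.mp h'
      exact hc (Sigma.mk.inj_iff.mp (Sum.inr_injective ht')).1.symm
    have hz'' : ∀ e, Sum.inr (Sum.inr ⟨c₀, t⟩) ∉ m.edgeLabels e := fun e h' => by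
      obtain ⟨t', ht'⟩ := mem_edgeLabels_mark.mp h'
      exact Sum.inr_ne_inl ht'
    obtain ⟨l₁, p, r, l₂, y, f, hl, hl', hy, hpr, hf, hfz⟩ := exists_identification h hz
      (m.circleLabels_nodup c₀) (mem_circleLabels_mark.mpr ⟨t, rfl⟩) (m'.circleLabels_ne_nil c₀)
      (h.map_circleLabels hz c₀)
    obtain ⟨A, B, hA, hA'⟩ :=
      exists_zip_rotate_eq (Sum.elim Sum.inl f) (hmerge f p r y hpr hfz) l₁ l₂
    obtain ⟨A', B', hB, hB'⟩ := exists_flatMap_eq _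
      (Finset.nodup_toList (Finset.univ : Finset D.Circle)) (k := c₀) (by simp)
      (F := m.circleArcs) (F' := m'.circleArcs) (by rw [circleArcs, hl, hA])
      (by rw [circleArcs, hl', hA']) (fun c hc => arcsC f c (hC f hf c (hz' c hc)))
    refine nonempty_iso_of_arcs m m' f h.incl hf _ (fun n hn => (hz n).mp hn) y hy hfz p r hpr
      ((Finset.univ : Finset D.Edge).toList.flatMap m.edgeArcs ++ A') B' ?_ ?_ ?_
    · rw [arcs, hB, List.append_assoc]
    · have hE' := funext fun e => arcsE f e (hE f hf e (hz'' e))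
      rw [arcs, hB', List.append_assoc, List.map_append (l₂ := A' ++ B'), List.map_flatMap,
        hE']
    · intro q
      have hfirst : ∀ e, m'.firstLabel e = Sum.elim Sum.inl f (m.firstLabel e) := fun e =>
        firstLabel_eq _ e (by rw [hE f hf e (hz'' e), List.head?_map])
      have hlast : ∀ e, m'.lastLabel e = Sum.elim Sum.inl f (m.lastLabel e) := fun e =>
        lastLabel_eq _ e (by rw [hE f hf e (hz'' e), List.getLast?_map])
      simp only [corners, Corners.map, hfirst, hlast]

/-- The marking with given sets of marks between those of `m'` and those of `m`. -/
def between {m' m : D.Marking} (s : D.Edge → Finset ℝ) (s' : D.Circle → Finset ℝ)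
    (h₁ : ∀ e, m'.edgeMarks e ⊆ s e) (h₁' : ∀ c, m'.circleMarks c ⊆ s' c)
    (h₂ : ∀ e, s e ⊆ m.edgeMarks e) (h₂' : ∀ c, s' c ⊆ m.circleMarks c) : D.Marking where
  edgeMarks := s
  circleMarks := s'
  edgeMarks_mem e t ht := m.edgeMarks_mem e t (h₂ e ht)
  circleMarks_mem c t ht := m.circleMarks_mem c t (h₂' c ht)
  internal_nonempty e he := (m'.internal_nonempty e he).mono (h₁ e)
  circle_nonempty c := (m'.circle_nonempty c).mono (h₁' c)

/-- A marking and a larger one have isomorphic complexes, by induction on the number of marks. -/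
theorem Subset.nonempty_iso {m' m : D.Marking} (h : m'.Subset m) :
    Nonempty (m.complex ≅ m'.complex) := by
  classical
  obtain ⟨k, hk⟩ : ∃ k, Fintype.card m.Mark = k := ⟨_, rfl⟩
  induction k using Nat.strong_induction_on generalizing m with
  | _ k ih =>
  by_cases hs : Function.Surjective h.incl
  · have hmm : m = m' := by
      obtain ⟨E, C, _, _, _, _⟩ := m
      obtain ⟨E', C', _, _, _, _⟩ := m'
      obtain rfl : E = E' := funext fun e => Finset.Subset.antisymm
        (fun t ht => h.exists_incl_eq_inl.mp (hs (Sum.inl ⟨e, t, ht⟩))) (h.1 e)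
      obtain rfl : C = C' := funext fun c => Finset.Subset.antisymm
        (fun t ht => h.exists_incl_eq_inr.mp (hs (Sum.inr ⟨c, t, ht⟩))) (h.2 c)
      rfl
    rw [hmm]
    exact ⟨Iso.refl _⟩
  · obtain ⟨z, hz⟩ := not_forall.mp hs
    -- the marking `m` without the mark `z`
    let s : D.Edge → Finset ℝ := fun e =>
      (m.edgeMarks e).filter fun t => ∃ ht, Sum.inl ⟨e, t, ht⟩ ≠ z
    let s' : D.Circle → Finset ℝ := fun c =>
      (m.circleMarks c).filter fun t => ∃ ht, Sum.inr ⟨c, t, ht⟩ ≠ z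
    have hs₁ : ∀ e, m'.edgeMarks e ⊆ s e := fun e t ht =>
      Finset.mem_filter.mpr ⟨h.1 e ht, h.1 e ht, fun hzt => hz ⟨Sum.inl ⟨e, t, ht⟩, hzt⟩⟩
    have hs₁' : ∀ c, m'.circleMarks c ⊆ s' c := fun c t ht =>
      Finset.mem_filter.mpr ⟨h.2 c ht, h.2 c ht, fun hzt => hz ⟨Sum.inr ⟨c, t, ht⟩, hzt⟩⟩
    let m'' : D.Marking := between (m' := m') (m := m) s s' hs₁ hs₁'
      (fun e => Finset.filter_subset _ _) (fun c => Finset.filter_subset _ _)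
    have h₁ : m'.Subset m'' := ⟨hs₁, hs₁'⟩
    have h₂ : m''.Subset m := ⟨fun e => Finset.filter_subset _ _, fun c => Finset.filter_subset _ _⟩
    have hz' : ∀ n, n ≠ z ↔ ∃ n', h₂.incl n' = n := by
      intro n
      constructor
      · intro hn
        rcases n with ⟨e, t, ht⟩ | ⟨c, t, ht⟩
        · exact ⟨Sum.inl ⟨e, t, Finset.mem_filter.mpr ⟨ht, ht, hn⟩⟩, rfl⟩
        · exact ⟨Sum.inr ⟨c, t, Finset.mem_filter.mpr ⟨ht, ht, hn⟩⟩, rfl⟩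
      · rintro ⟨⟨e, t, ht⟩ | ⟨c, t, ht⟩, rfl⟩
        · exact (Finset.mem_filter.mp ht).2.2
        · exact (Finset.mem_filter.mp ht).2.2
    obtain ⟨i⟩ := nonempty_iso_of_remove_one h₂ z hz'
    have hcard : Fintype.card m''.Mark < k :=
      hk ▸ Fintype.card_lt_of_injective_of_notMem _ h₂.incl_injective (b := z)
        fun ⟨n', hn'⟩ => (hz' z).mpr ⟨n', hn'⟩ rfl
    obtain ⟨i'⟩ := ih _ hcard h₁ rfl
    exact ⟨i ≪≫ i'⟩

open Classical in
/-- The common refinement of two markings. -/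
noncomputable def union (m₁ m₂ : D.Marking) : D.Marking where
  edgeMarks e := m₁.edgeMarks e ∪ m₂.edgeMarks e
  circleMarks c := m₁.circleMarks c ∪ m₂.circleMarks c
  edgeMarks_mem e t ht :=
    (Finset.mem_union.mp ht).elim (m₁.edgeMarks_mem e t) (m₂.edgeMarks_mem e t)
  circleMarks_mem c t ht :=
    (Finset.mem_union.mp ht).elim (m₁.circleMarks_mem c t) (m₂.circleMarks_mem c t)
  internal_nonempty e he := (m₁.internal_nonempty e he).mono Finset.subset_union_left
  circle_nonempty c := (m₁.circle_nonempty c).mono Finset.subset_union_left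

end TangleDiagram.Marking

end KR

theorem mainTheorem4 (D : KR.TangleDiagram) (m₁ m₂ : D.Marking) :
    Nonempty (m₁.complex ≅ m₂.complex) := by
  have h₁ : m₁.Subset (m₁.union m₂) :=
    ⟨fun _ => Finset.subset_union_left, fun _ => Finset.subset_union_left⟩
  have h₂ : m₂.Subset (m₁.union m₂) :=
    ⟨fun _ => Finset.subset_union_right, fun _ => Finset.subset_union_right⟩
  obtain ⟨i₁⟩ := h₁.nonempty_iso
  obtain ⟨i₂⟩ := h₂.nonempty_iso
  exact ⟨i₁.symm ≪≫ i₂⟩
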